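/- **Setting.** Let $\mathcal E$ be a finite nonempty set of strings in the sphere: simple arcs with pairwise distinct endpoints, finitely many intersection points, each of them a crossing of exactly two strings, and with connected union (two strings may cross several times). Ground $\mathcal E$: in each face of $\mathcal E$ in which strings end, draw one simple closed boundary curve, meeting $\mathcal E$ exactly in those endpoints. The *net* $\mathcal N$ is the dual plane graph: its vertices are the cells of the grounded system other than the discs bounded by a single boundary curve, its edges are dual to the pieces of strings between consecutive crossings or endpoints, and its faces are the *boundary-holes* (one per boundary curve) and the *squares* (one per crossing). The edges dual to pieces containing a string endpoint are drawn along the boundary curves; they and the vertices on boundary curves form the *border*. A non-border vertex is *regular* if it has degree 4 and a *vertex-hole* otherwise. A *hole* is a vertex-hole or a boundary-hole. A *rectangle* is a set of squares arranged as an $n\times m$ grid ($n,m\ge1$), together with the net edges between grid-neighbours, where neighbouring squares share the corresponding sides; equivalently, an $n\times m$ bundle of crossings. A *rectangulation* is a partition of the squares into rectangles; it is *optimal* if the number of rectangles is minimum, and $R_{opt}$ is this minimum. An edge is *separating* if it is not a border edge and not inside a rectangle. A *straight path* is a path of $\mathcal N$ (its two ends may coincide) whose non-end vertices are regular and are traversed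 between opposite edges. A *cut-set* is a set of edge-disjoint straight paths (*segments*), no two passing through each other, each end of which is on a hole or in the interior of another segment. It *delimits* a rectangulation if its edges are exactly the separating edges; the segments of a rectangulation are those of a delimiting cut-set. For a rectangulation $\mathcal R$, $\delta(\mathcal R)$ is the minimum, over all holes $h$, of the number of segments of $\mathcal R$ incident with $h$ (a segment with both ends on $h$ is counted twice), and $\delta(\mathcal N)$ is the minimum of $\delta(\mathcal R)$ over all optimal rectangulations $\mathcal R$. An edge-set *saturates* a vertex $v$ if $v$ is regular and not incident with it, or if at least one edge of it or of the border is incident with $v$ and every angle at $v$ between consecutive such edges sees at most two squares. The *exponent* of $v$ is the minimum size of an edge-set saturating $v$. The *greedy strategy* takes the vertices of positive exponent one by one in some linear order; at each vertex $v$ it adds, one after the other, a minimum number of segments shot from $v$ along edges not yet covered such that $v$ becomes saturated by the covered edges. A segment shot from $v$ goes straight until it first meets a hole or an earlier segment. **Proposition.** Suppose that $\delta(\mathcal N)\ge 3$, or merely that some optimal rectangulation $\mathcal R$ has $\delta(\mathcal R)\ge3$, i.e. every hole is incident with at least 3 segments of $\mathcal R$. Then, for every linear order of the vertices of positive exponent,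 the greedy strategy can be carried out, and every run of it produces a cut-set that delimits a unique rectangulation, whose number $R_{greed}$ of rectangles satisfies $$R_{greed}\le 4R_{opt}-2 .$$ -/

import Mathlib

/-- A finite, connected set of strings (simple arcs) on the sphere, in general position, given by the
rotation system of its planarization. Its vertices are the crossings (degree 4) and the endpoints of
the strings (degree 1); its edges are the pieces of strings between consecutive vertices. `D` is the
set of darts (oriented edges, each based at its tail), `rev d` is `d` with the opposite orientation
and `rot d` is the next dart counterclockwise around the tail of `d`. At a crossing, a string
continues from one dart to the opposite one. -/
structure StringSystem (D : Type*) where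
  rot : Equiv.Perm D
  rev : Equiv.Perm D
  rev_rev : ∀ d, rev (rev d) = d
  rev_ne : ∀ d, rev d ≠ d
  /-- Every vertex has degree 1 (endpoint of a string) or degree 4 (crossing). -/
  degree : ∀ d, rot d = d ∨ (rot (rot d) ≠ d ∧ rot (rot (rot (rot d))) = d)
  nonempty : Nonempty D
  /-- The union of the strings is connected. -/
  connected : ∀ d e : D, ∃ g ∈ Subgroup.closure {rot, rev}, g d = e
  /-- The drawing lies on the sphere: Euler's formula `V + F = E + 2`. Vertices, edges and faces are
  the orbits of `rot`, of `rev`, and of `d ↦ rot⁻¹ (rev d)` (the face on the left of `d`). -/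
  euler : Nat.card (Quotient (Equiv.Perm.SameCycle.setoid rot))
      + Nat.card (Quotient (Equiv.Perm.SameCycle.setoid (rot⁻¹ * rev)))
    = Nat.card (Quotient (Equiv.Perm.SameCycle.setoid rev)) + 2
  /-- No string is a closed curve. The permutation `d ↦ rot (rot (rev d))` walks along a string and
  turns back at the ends of the string. -/
  not_closed : ∀ d, ∃ e, Equiv.Perm.SameCycle (rot * rot * rev) d e ∧ rot e = e
  /-- No string crosses itself. -/
  not_selfcrossing : ∀ d, rot d ≠ d → ¬ Equiv.Perm.SameCycle (rot * rot * rev) d (rot d)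

namespace StringSystem

variable {D : Type*} (E : StringSystem D)

/-! ### Strings, faces and the grounding -/

/-- The tail of `d` is an endpoint of a string. -/
def AtEnd (d : D) : Prop := E.rot d = d

/-- The tail of `d` is a crossing. -/
def AtCrossing (d : D) : Prop := ¬ E.AtEnd d

/-- Vertices of the planarization; those that are crossings are the squares of the net. -/
abbrev Vertex : Type _ := Quotient (Equiv.Perm.SameCycle.setoid E.rot)

/-- The tail of a dart. -/
def vertex (d : D) : E.Vertex := Quotient.mk _ d

/-- The face walk: the dart that follows `d` on the boundary of the face on the left of `d`. -/
def next : Equiv.Perm D := E.rot⁻¹ * E.rev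

/-- Faces of the set of strings. -/
abbrev Face : Type _ := Quotient (Equiv.Perm.SameCycle.setoid E.next)

/-- The face on the left of a dart. -/
def face (d : D) : E.Face := Quotient.mk _ d

/-! ### The dual net

The strings are grounded by one boundary curve in each face in which strings end; the curve visits
the endpoints in the order of the face walk. This cuts such a face into a boundary-hole and one
cell for each stretch of the face walk between two consecutive endpoints. A face without endpoints is a
cell. The cells are the vertices of the net. The edges of the net are dual to the edges of the
planarization: the dart `d` of the net leads from the cell on the left of `d` to the cell on the left
of `rev d`, and the darts of the net at a cell are met in the order of the face walk, a square
(the crossing at the head of `d`) lying between `d` and `next d`, unless the head of `d` is an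
endpoint; there the boundary curve lies between them. -/

/-- Vertices of the net: `d` and `next d` lie on the same cell unless the head of `d` is an
endpoint of a string. -/
def Cell : Type _ := Quot fun d e : D => ¬ E.AtEnd (E.rev d) ∧ e = E.next d

/-- The cell on the left of `d`, where the dart `d` of the net starts. -/
def cell (d : D) : E.Cell := Quot.mk _ d

/-- Border edges of the net: those dual to a piece of a string that contains an endpoint. They are
drawn along the boundary curves. -/
def IsBorder (d : D) : Prop := E.AtEnd d ∨ E.AtEnd (E.rev d)

/-- Net vertices not on the border. -/
def IsInterior (c : E.Cell) : Prop := ∀ d, E.cell d = c → ¬ E.IsBorder d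

/-- The degree of a vertex of the net. -/
noncomputable def deg (c : E.Cell) : ℕ := Nat.card {d : D // E.cell d = c}

/-- Regular vertices: interior vertices of degree 4. -/
def IsRegular (c : E.Cell) : Prop := E.IsInterior c ∧ E.deg c = 4

/-- Vertex-holes: interior vertices that are not regular. -/
def IsVertexHole (c : E.Cell) : Prop := E.IsInterior c ∧ E.deg c ≠ 4

/-- Faces in which a string ends; each contains exactly one boundary-hole. -/
def HasBoundaryHole (f : E.Face) : Prop := ∃ d, E.face d = f ∧ E.AtEnd d

/-- Holes of the net: vertex-holes and boundary-holes. -/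
abbrev Hole : Type _ := {c : E.Cell // E.IsVertexHole c} ⊕ {f : E.Face // E.HasBoundaryHole f}

/-- The dart `d` of the net starts on the hole `h`, i.e. at the vertex-hole `h` or at a vertex on the
boundary of the boundary-hole `h`. -/
def StartsOn (d : D) : E.Hole → Prop
  | Sum.inl c => E.cell d = c.1
  | Sum.inr f => E.face d = f.1

/-! ### Rectangulations -/

/-- A bundle of crossings, as a subgraph of the planarization: its vertices (the squares of the
net that form the rectangle) and its edges (dual to the net edges inside the rectangle), the latter as
a set of darts. -/
@[ext]
structure Rect where
  squares : Set E.Vertex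
  inner : Set D

/-- `r` is an `n × m` grid of pairwise distinct crossings, for some `n, m ≥ 1`. Here `q i j` is the
dart that leaves the crossing in position `(i, j)` to the east; `rot (q i j)`, `rot (rot (q i j))` and
`rot (rot (rot (q i j)))` leave it to the north, west and south. -/
def IsRectangle (r : E.Rect) : Prop :=
  ∃ (n m : ℕ) (q : ℕ → ℕ → D), 0 < n ∧ 0 < m ∧
    (∀ i < n, ∀ j < m, E.AtCrossing (q i j)) ∧
    (∀ i < n, ∀ j < m, ∀ i' < n, ∀ j' < m,
      E.vertex (q i j) = E.vertex (q i' j') → i = i' ∧ j = j') ∧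
    (∀ i < n, ∀ j, j + 1 < m → E.rev (q i j) = E.rot (E.rot (q i (j + 1)))) ∧
    (∀ i, i + 1 < n → ∀ j < m,
      E.rev (E.rot (q i j)) = E.rot (E.rot (E.rot (q (i + 1) j)))) ∧
    r.squares = {v | ∃ i < n, ∃ j < m, v = E.vertex (q i j)} ∧
    r.inner = {d |
      (∃ i < n, ∃ j, j + 1 < m ∧ (d = q i j ∨ E.rev d = q i j)) ∨
      (∃ i, i + 1 < n ∧ ∃ j < m, (d = E.rot (q i j) ∨ E.rev d = E.rot (q i j)))}

/-- A rectangulation: a partition of the squares into rectangles. -/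
def IsRectangulation (R : Finset E.Rect) : Prop :=
  (∀ r ∈ R, E.IsRectangle r) ∧
  ∀ d, E.AtCrossing d → ∃! r, r ∈ R ∧ E.vertex d ∈ r.squares

/-- A rectangulation with the fewest rectangles. -/
def IsOptimal (R : Finset E.Rect) : Prop :=
  E.IsRectangulation R ∧ ∀ R', E.IsRectangulation R' → R.card ≤ R'.card

/-- The number of rectangles of an optimal rectangulation. -/
noncomputable def Ropt : ℕ := sInf {k | ∃ R, E.IsRectangulation R ∧ R.card = k}

/-- Separating edges: edges between two squares that do not lie inside a rectangle. (Two squares of one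
rectangle may also be glued along an edge that is not inside the rectangle; such an edge separates
the rectangle from itself.) -/
def IsSeparating (R : Finset E.Rect) (d : D) : Prop :=
  ¬ E.IsBorder d ∧ ∀ r ∈ R, d ∉ r.inner

/-! ### Segments -/

/-- The dart of the net that continues `d` straight ahead, when `d` leads to a regular vertex: the
one opposite to `rev d` in the rotation. -/
def straight (d : D) : D := E.next (E.next (E.rev d))

/-- The non-end vertices of the path with the given list of darts. -/
def innerVertices (s : List D) : List E.Cell := s.tail.map E.cell

/-- Straight paths of the net, as lists of consecutive darts; the two ends may coincide. -/
def IsStraightPath (s : List D) : Prop :=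
  s ≠ [] ∧ s.IsChain (fun a b => E.IsRegular (E.cell (E.rev a)) ∧ b = E.straight a) ∧
    (E.innerVertices s).Nodup

/-- The edges, as a set of darts, that are contained in a segment of `S`. -/
def covered (S : Finset (List D)) : Set D := {d | ∃ s ∈ S, d ∈ s ∨ E.rev d ∈ s}

/-- The vertex `c` is on a hole, or in the interior of a path of `S` other than `s`. -/
def IsValidEnd (S : Finset (List D)) (s : List D) (c : E.Cell) : Prop :=
  ¬ E.IsRegular c ∨ ∃ t ∈ S, t ≠ s ∧ c ∈ E.innerVertices t

/-- Cut-sets: sets of edge-disjoint straight paths, no two of which pass through each other, whose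
ends are on holes or in the interior of other paths of the set. -/
def IsCutSet (S : Finset (List D)) : Prop :=
  (∀ s ∈ S, E.IsStraightPath s) ∧
  (∀ s ∈ S, ∀ t ∈ S, s ≠ t →
    (∀ d ∈ s, d ∉ t ∧ E.rev d ∉ t) ∧ ∀ c ∈ E.innerVertices s, c ∉ E.innerVertices t) ∧
  (∀ s ∈ S, (∀ d ∈ s.head?, E.IsValidEnd S s (E.cell d)) ∧
    ∀ d ∈ s.getLast?, E.IsValidEnd S s (E.cell (E.rev d)))

/-- The cut-set `S` delimits the rectangulation `R`. -/
def Delimits (S : Finset (List D)) (R : Finset E.Rect) : Prop :=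
  E.IsCutSet S ∧ ∀ d, d ∈ E.covered S ↔ E.IsSeparating R d

open Classical in
/-- The number of segments of `S` incident with the hole `h`, a segment with both ends on `h` being
counted twice. -/
noncomputable def incidence (S : Finset (List D)) (h : E.Hole) : ℕ :=
  ∑ s ∈ S, ((if ∃ d ∈ s.head?, E.StartsOn d h then 1 else 0)
    + (if ∃ d ∈ s.getLast?, E.StartsOn (E.rev d) h then 1 else 0))

/-- `δ(R)`, for a rectangulation `R` whose segments are `S`: the minimum number of segments
incident with a hole. -/
noncomputable def deltaRect (S : Finset (List D)) : ℕ := ⨅ h : E.Hole, E.incidence S h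

/-- `δ(N)`: the minimum of `δ(R)` over the optimal rectangulations `R`. -/
noncomputable def delta : ℕ :=
  sInf {k | ∃ R S, E.IsOptimal R ∧ E.Delimits S R ∧ E.deltaRect S = k}

/-! ### The greedy strategy -/

/-- The set `X` of edges (given by one or both of their darts) saturates the vertex `c`: either `c` is
regular and not incident with `X`, or each angle at `c` between consecutive edges of `X` and of the
border sees at most two squares, i.e. the next such edge comes after at most two steps of the
rotation at `c`. -/
def Saturates (X : Set D) (c : E.Cell) : Prop :=
  let Y : Set D := {d | d ∈ X ∨ E.rev d ∈ X ∨ E.IsBorder d}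
  (E.IsRegular c ∧ ∀ d, E.cell d = c → d ∉ Y) ∨
  ((∃ d, E.cell d = c ∧ d ∈ Y) ∧
    ∀ d, E.cell d = c → d ∈ Y → E.next d ∈ Y ∨ E.next (E.next d) ∈ Y)

/-- The exponent of a vertex: the minimum number of edges in an edge-set saturating it. -/
noncomputable def exponent (c : E.Cell) : ℕ :=
  sInf {k | ∃ X : Finset D, X.card = k ∧ E.Saturates (X : Set D) c}

/-- The vertex `c` lies on a segment of `S`. -/
def OnSegment (S : Finset (List D)) (c : E.Cell) : Prop := ∃ d ∈ E.covered S, E.cell d = c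

/-- `s` is the segment shot along `d` in the presence of `S`: it starts with the edge `d`, which
is not yet covered, and goes straight ahead until it first meets a hole or a segment of `S`. -/
def IsShot (S : Finset (List D)) (d : D) (s : List D) : Prop :=
  ¬ E.IsBorder d ∧ d ∉ E.covered S ∧ E.IsStraightPath s ∧ s.head? = some d ∧
  (∀ c ∈ E.innerVertices s, ¬ E.OnSegment S c) ∧
  ∀ e ∈ s.getLast?, ¬ E.IsRegular (E.cell (E.rev e)) ∨ E.OnSegment S (E.cell (E.rev e))

open Classical in
/-- `T` is obtained from `S` by shooting `k` segments, one after the other, from the vertex `c`. -/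
inductive Shots (c : E.Cell) : Finset (List D) → ℕ → Finset (List D) → Prop
  | nil (S : Finset (List D)) : Shots c S 0 S
  | cons (S T : Finset (List D)) (k : ℕ) (d : D) (s : List D) :
      E.cell d = c → E.IsShot S d s → Shots c (insert s S) k T → Shots c S (k + 1) T

/-- One step of the greedy strategy: shoot the fewest segments from `c` that saturate `c`. -/
def GreedyStep (c : E.Cell) (S T : Finset (List D)) : Prop :=
  ∃ k, E.Shots c S k T ∧ E.Saturates (E.covered T) c ∧
    ∀ k' T', E.Shots c S k' T' → E.Saturates (E.covered T') c → k ≤ k'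

/-- The greedy strategy leads from `S` to `T` when it treats the listed vertices in this order. -/
def GreedyRun : List E.Cell → Finset (List D) → Finset (List D) → Prop
  | [], S, T => T = S
  | c :: cs, S, T => ∃ S', E.GreedyStep c S S' ∧ GreedyRun cs S' T

end StringSystem

namespace StringSystem

variable {D : Type*} (E : StringSystem D)

/-! ### Rotations, cells and faces -/

/-! Two things are needed: saturated cut-sets cut out rectangles, and a cut-set with few segments
cuts out few of them.

Cutting out rectangles. Call the edges of a cut-set and of the border walls. Once every vertex is
saturated, two consecutive non-walls at a square span a net vertex of degree 4 without walls
(`isFlat_of_saturates`). Going west and then south from a square until a wall leads to a corner,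
from which rows and columns fill a grid bounded by walls (`IsFlat.isGrid`). The grid does not
overlap itself: squares in equal position have equal distances to the walls, a quarter turn would
make a string cross itself, and a half turn would fix the centre of a square, an edge or a vertex
(`IsGrid.vertex_injective`). These blocks partition the squares and are determined by the walls,
whence existence and uniqueness. The greedy strategy never gets stuck: a straight walk that starts
at a non-regular vertex does not revisit a vertex, again because no string crosses itself
(`walk_cell_ne`), so by finiteness it ends.

Counting. Each rectangle has four corners, and counting corners dart by dart shows that the numbers
`R` of rectangles and `S` of segments differ by a constant of the net (`Delimits.card_eq`). With
Euler's formula (`euler_bound`), `R ≥ S + 2 - H` for `H` holes. If each hole meets at least 3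
segment ends, then `3H ≤ 2S`, hence `S ≤ 3R - 6`. The segments of the optimal rectangulation
saturate all vertices, and at non-regular vertices they only have ends, so the exponents add up to
at most `2S` (`sum_exponent_le`). The greedy strategy shoots at most as many segments from a vertex
as its exponent, thus `S' ≤ 2S` in total, and `R' = R + S' - S ≤ R + S`, which is within the bound.
-/

theorem rot_four (d : D) : E.rot (E.rot (E.rot (E.rot d))) = d := by
  rcases E.degree d with h | h
  · simp [h]
  · exact h.2

theorem rot_inv_apply (d : D) : E.rot⁻¹ d = E.rot (E.rot (E.rot d)) := by
  rw [Equiv.Perm.inv_eq_iff_eq, E.rot_four]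

theorem next_apply (d : D) : E.next d = E.rot (E.rot (E.rot (E.rev d))) := by
  rw [next, Equiv.Perm.mul_apply, rot_inv_apply]

theorem rot_rot_ne {d : D} (h : E.AtCrossing d) : E.rot (E.rot d) ≠ d := by
  rcases E.degree d with h' | h'
  · exact absurd h' h
  · exact h'.1

theorem atEnd_rot {d : D} : E.AtEnd (E.rot d) ↔ E.AtEnd d := by
  simp [AtEnd]

theorem atCrossing_rot {d : D} : E.AtCrossing (E.rot d) ↔ E.AtCrossing d := by
  simp [AtCrossing, atEnd_rot]

theorem rot_rot_rot_ne {d : D} (h : E.AtCrossing d) : E.rot (E.rot (E.rot d)) ≠ d := by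
  intro h'
  have := E.rot_four d
  rw [h'] at this
  exact h this

theorem atEnd_next {d : D} : E.AtEnd (E.next d) ↔ E.AtEnd (E.rev d) := by
  simp [next_apply, atEnd_rot]

theorem vertex_rot (d : D) : E.vertex (E.rot d) = E.vertex d :=
  Quotient.sound ⟨-1, by simp⟩

theorem iterate_rot_eq (k : ℕ) (d : D) : (E.rot ^ k) d = (E.rot ^ (k % 4)) d := by
  have h4 : E.rot ^ 4 = 1 := by
    ext d
    simpa [pow_succ] using E.rot_four d
  rw [pow_eq_pow_mod k h4]

theorem vertex_eq_iff [Finite D] {d e : D} : E.vertex d = E.vertex e ↔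
    d = e ∨ d = E.rot e ∨ d = E.rot (E.rot e) ∨ d = E.rot (E.rot (E.rot e)) := by
  constructor
  · intro h
    have h' : E.rot.SameCycle e d := (Quotient.exact h : E.rot.SameCycle d e).symm
    obtain ⟨k, -, hk⟩ := h'.exists_pow_eq'
    rw [iterate_rot_eq] at hk
    have : k % 4 < 4 := Nat.mod_lt _ (by norm_num)
    generalize k % 4 = j at hk this
    interval_cases j <;> simp [pow_succ] at hk <;> simp [← hk]
  · rintro (rfl | rfl | rfl | rfl) <;> simp [vertex_rot]

theorem atCrossing_of_vertex_eq [Finite D] {d e : D} (h : E.vertex d = E.vertex e)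
    (hd : E.AtCrossing d) : E.AtCrossing e := by
  rcases E.vertex_eq_iff.1 h with rfl | rfl | rfl | rfl <;> simpa [atCrossing_rot] using hd

theorem cell_next {d : D} (h : ¬ E.AtEnd (E.rev d)) : E.cell (E.next d) = E.cell d :=
  (Quot.sound ⟨h, rfl⟩).symm

theorem iff_of_cell_eq {P : D → Prop} (h : ∀ d, ¬ E.AtEnd (E.rev d) → (P d ↔ P (E.next d)))
    {d e : D} (hc : E.cell d = E.cell e) : P d ↔ P e := by
  let f : E.Cell → Prop :=
    Quot.lift P (by rintro a b ⟨h1, rfl⟩; exact propext (h a h1))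
  exact iff_of_eq (congrArg f hc)

theorem face_next (d : D) : E.face (E.next d) = E.face d :=
  Quotient.sound ⟨-1, by simp⟩

theorem face_eq_of_cell_eq {d e : D} (h : E.cell d = E.cell e) : E.face d = E.face e :=
  ((E.iff_of_cell_eq (P := fun x => E.face x = E.face e)
    (fun d _ => by rw [face_next])) h).2 rfl

theorem exists_cell_eq (c : E.Cell) : ∃ d, E.cell d = c := Quot.exists_rep c

theorem isBorder_rev {d : D} : E.IsBorder (E.rev d) ↔ E.IsBorder d := by
  simp [IsBorder, E.rev_rev, or_comm]

theorem isBorder_next {d : D} (h : E.AtEnd (E.rev d)) : E.IsBorder (E.next d) := by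
  left
  rwa [atEnd_next]

theorem not_isBorder_of_regular {d : D} (h : E.IsRegular (E.cell d)) : ¬ E.IsBorder d :=
  h.1 d rfl

theorem exists_iterate_next_of_face_eq [Finite D] {d e : D} (h : E.face d = E.face e) :
    ∃ k, (E.next)^[k] d = e := by
  have h' : E.next.SameCycle d e := Quotient.exact h
  obtain ⟨k, -, hk⟩ := h'.exists_pow_eq'
  exact ⟨k, by rw [Equiv.Perm.iterate_eq_pow, hk]⟩

theorem cell_iterate_next {d : D} (h : E.IsInterior (E.cell d)) (k : ℕ) :
    E.cell ((E.next)^[k] d) = E.cell d := by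
  induction k with
  | zero => rfl
  | succ k ih =>
    rw [Function.iterate_succ_apply', cell_next, ih]
    intro h'
    exact h _ ih (Or.inr h')

/-- Along the boundary of a face, induction from one dart reaches the whole face. -/
theorem face_induction [Finite D] {P : D → Prop} (h : ∀ d, P d → P (E.next d)) {d e : D}
    (hd : P d) (hf : E.face d = E.face e) : P e := by
  obtain ⟨k, rfl⟩ := E.exists_iterate_next_of_face_eq hf
  induction k with
  | zero => exact hd
  | succ k ih =>
    rw [Function.iterate_succ_apply']
    exact h _ (ih (by rw [hf, Function.iterate_succ_apply', face_next]))

/-- No endpoint interrupts the face walk around an interior cell, so the darts of the cell form a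
full orbit of `next`. -/
theorem deg_eq_minimalPeriod [Finite D] {d : D} (h : E.IsInterior (E.cell d)) :
    E.deg (E.cell d) = Function.minimalPeriod E.next d := by
  have hp : 0 < Function.minimalPeriod E.next d := by
    apply Function.minimalPeriod_pos_of_mem_periodicPts
    exact (Function.Injective.mem_periodicPts E.next.injective d)
  have hs : {e | E.cell e = E.cell d} =
      (fun k => (E.next)^[k] d) '' Set.Iio (Function.minimalPeriod E.next d) := by
    ext e
    constructor
    · intro he
      obtain ⟨k, hk⟩ := E.exists_iterate_next_of_face_eq (E.face_eq_of_cell_eq he.symm)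
      exact ⟨k % Function.minimalPeriod E.next d, Nat.mod_lt _ hp, by
        rw [← hk]; exact Function.iterate_mod_minimalPeriod_eq⟩
    · rintro ⟨k, -, rfl⟩
      exact E.cell_iterate_next h k
  change Set.ncard {e | E.cell e = E.cell d} = _
  rw [hs, Function.iterate_injOn_Iio_minimalPeriod.ncard_image]
  rw [Set.ncard_eq_toFinset_card']
  simp

/-- The period of `d` divides 4 but not 2, so it is 4. -/
theorem isRegular_of_next_four [Finite D] {d : D} (h : E.next (E.next (E.next (E.next d))) = d)
    (h2 : E.next (E.next d) ≠ d) (hb : ∀ k < 4, ¬ E.IsBorder ((E.next)^[k] d)) :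
    E.IsRegular (E.cell d) := by
  have h4 : Function.minimalPeriod E.next d ∣ 4 :=
    Function.IsPeriodicPt.minimalPeriod_dvd (n := 4) h
  have hn2 : ¬ Function.minimalPeriod E.next d ∣ 2 := by
    intro h'
    exact h2 (Function.isPeriodicPt_iff_minimalPeriod_dvd.2 h')
  have h4' : Function.minimalPeriod E.next d = 4 := by
    have := Nat.le_of_dvd (by norm_num) h4
    interval_cases Function.minimalPeriod E.next d <;> simp_all
  have hi : E.IsInterior (E.cell d) := by
    intro e he
    obtain ⟨k, rfl⟩ := E.exists_iterate_next_of_face_eq (E.face_eq_of_cell_eq he.symm)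
    rw [← Function.iterate_mod_minimalPeriod_eq, h4']
    exact hb _ (Nat.mod_lt _ (by norm_num))
  exact ⟨hi, by rw [deg_eq_minimalPeriod _ hi, h4']⟩

section Regular

variable [Finite D] {d : D} (h : E.IsRegular (E.cell d))
include h

theorem minimalPeriod_of_regular : Function.minimalPeriod E.next d = 4 := by
  rw [← E.deg_eq_minimalPeriod h.1, h.2]

theorem next_four : E.next (E.next (E.next (E.next d))) = d :=
  Function.isPeriodicPt_iff_minimalPeriod_dvd.2 (E.minimalPeriod_of_regular h).dvd

theorem next_two_ne : E.next (E.next d) ≠ d := by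
  intro h'
  have : Function.minimalPeriod E.next d ∣ 2 := Function.IsPeriodicPt.minimalPeriod_dvd (n := 2) h'
  rw [E.minimalPeriod_of_regular h] at this
  norm_num at this

theorem eq_of_cell_eq_regular {e : D} (he : E.cell e = E.cell d) :
    e = d ∨ e = E.next d ∨ e = E.next (E.next d) ∨ e = E.next (E.next (E.next d)) := by
  obtain ⟨k, rfl⟩ := E.exists_iterate_next_of_face_eq (E.face_eq_of_cell_eq he.symm)
  rw [← Function.iterate_mod_minimalPeriod_eq, E.minimalPeriod_of_regular h]
  have := Nat.mod_lt k (show 4 > 0 by norm_num)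
  interval_cases k % 4 <;> simp

end Regular

theorem cell_next_of_regular {d : D} (h : E.IsRegular (E.cell d)) :
    E.cell (E.next d) = E.cell d :=
  E.cell_iterate_next h.1 1

/-- A vertex-hole fills its whole face and has no border dart, whereas a face with a boundary-hole
contains one. -/
theorem hole_unique {d : D} {h h' : E.Hole} (hd : E.StartsOn d h) (hd' : E.StartsOn d h')
    [Finite D] : h = h' := by
  have key : ∀ (c : {c : E.Cell // E.IsVertexHole c}) (f : {f : E.Face // E.HasBoundaryHole f}),
      E.StartsOn d (Sum.inl c) → E.StartsOn d (Sum.inr f) → False := by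
    rintro ⟨c, hc⟩ ⟨f, e, he, hend⟩ (h1 : E.cell d = c) (h2 : E.face d = f)
    subst h1
    obtain ⟨k, rfl⟩ := E.exists_iterate_next_of_face_eq (h2.trans he.symm)
    exact hc.1 _ (E.cell_iterate_next hc.1 k) (Or.inl hend)
  rcases h with c | f <;> rcases h' with c' | f'
  · have h1 : E.cell d = c.1 := hd
    have h2 : E.cell d = c'.1 := hd'
    rw [Subtype.ext (h1.symm.trans h2)]
  · exact (key _ _ hd hd').elim
  · exact (key _ _ hd' hd).elim
  · have h1 : E.face d = f.1 := hd
    have h2 : E.face d = f'.1 := hd'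
    rw [Subtype.ext (h1.symm.trans h2)]

/-! ### Walking along strings -/

/-- The walk along a string: the dart opposite to `rev d` at the head of `d`. -/
def fwd : Equiv.Perm D := E.rot * E.rot * E.rev

theorem fwd_apply (d : D) : E.fwd d = E.rot (E.rot (E.rev d)) := rfl

theorem rot_rot_fwd (d : D) : E.rot (E.rot (E.fwd d)) = E.rev d := E.rot_four _

theorem fwd_rot_rot_fwd (d : D) : E.fwd (E.rot (E.rot (E.fwd d))) = E.rot (E.rot d) := by
  rw [rot_rot_fwd, fwd_apply, E.rev_rev]

theorem exists_iterate_fwd_atEnd [Finite D] (d : D) : ∃ k, E.AtEnd ((E.fwd)^[k] d) := by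
  obtain ⟨e, he, hend⟩ := E.not_closed d
  obtain ⟨k, -, hk⟩ := he.exists_pow_eq'
  refine ⟨k, ?_⟩
  rw [Equiv.Perm.iterate_eq_pow]
  change E.AtEnd (((E.rot * E.rot * E.rev) ^ k) d)
  rw [hk]
  exact hend

theorem sameCycle_fwd (d : D) : E.fwd.SameCycle d (E.fwd d) := ⟨1, by simp⟩

theorem not_sameCycle_rot {d : D} (h : E.AtCrossing d) : ¬ E.fwd.SameCycle d (E.rot d) :=
  E.not_selfcrossing d h

/-! ### Flat edge sets and grids -/

/-- The dart that leaves the northern neighbour of the tail of `d` to the east, when `d` leaves its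
tail to the east. -/
def up (d : D) : D := E.rot (E.rev (E.rot d))

theorem rot_up (d : D) : E.rot (E.up d) = E.fwd (E.rot d) := rfl

/-- An edge set that contains the border and has no angle of more than two squares, given locally: two
consecutive absent edges at a square belong to a net vertex of degree 4 without present edges. -/
structure IsFlat (Y : Set D) : Prop where
  rev_mem : ∀ d, E.rev d ∈ Y ↔ d ∈ Y
  atEnd_mem : ∀ d, E.AtEnd d → d ∈ Y
  flat : ∀ x, x ∉ Y → E.rot x ∉ Y → E.rot (E.fwd x) ∉ Y ∧ E.up x ∉ Y ∧
    E.fwd (E.up x) = E.up (E.fwd x) ∧ E.rot (E.fwd x) ≠ E.rev (E.rot x)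

variable {E}

namespace IsFlat

variable {Y : Set D} (hY : E.IsFlat Y)
include hY

theorem atCrossing {x : D} (h : x ∉ Y) : E.AtCrossing x := fun h' => h (hY.atEnd_mem x h')

theorem atCrossing_fwd {x : D} (h : x ∉ Y) : E.AtCrossing (E.fwd x) := by
  rw [fwd_apply, atCrossing_rot, atCrossing_rot]
  exact hY.atCrossing (by rwa [hY.rev_mem])

/-- A wall along the north side of a row cannot stop between two squares of the row: flatness
applied at either of the two squares carries the absence of the edge over to the other. -/
theorem north_iff {x : D} (h : x ∉ Y) : E.rot x ∈ Y ↔ E.rot (E.fwd x) ∈ Y := by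
  constructor
  · intro h1
    by_contra h2
    have h3 : E.rot (E.rot (E.fwd x)) ∉ Y := by rwa [rot_rot_fwd, hY.rev_mem]
    have := (hY.flat _ h2 h3).2.1
    apply this
    rwa [up, rot_rot_fwd, E.rev_rev]
  · intro h1
    by_contra h2
    exact (hY.flat _ h h2).1 h1

theorem south_iff {x : D} (h : x ∉ Y) :
    E.rot (E.rot (E.rot x)) ∈ Y ↔ E.rot (E.rot (E.rot (E.fwd x))) ∈ Y := by
  have h1 : E.rev x ∉ Y := by rwa [hY.rev_mem]
  have := hY.north_iff h1
  rw [fwd_apply, E.rev_rev] at this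
  rw [rot_rot_fwd, this]

theorem east_iff {x : D} (h : E.rot x ∉ Y) : x ∈ Y ↔ E.up x ∈ Y := by
  have := hY.south_iff h
  rwa [E.rot_four, ← rot_up, E.rot_four] at this

theorem west_iff {x : D} (h : E.rot x ∉ Y) :
    E.rot (E.rot x) ∈ Y ↔ E.rot (E.rot (E.up x)) ∈ Y :=
  hY.north_iff h

end IsFlat

/-- A grid with `b + 1` rows and `a + 1` columns, whose inner edges are not in `Y` and whose outer
edges are in `Y`; `q i j` leaves the square in row `i` and column `j` to the east. -/
structure IsGrid (E : StringSystem D) (Y : Set D) (a b : ℕ) (q : ℕ → ℕ → D) : Prop where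
  cross : ∀ i ≤ b, ∀ j ≤ a, E.AtCrossing (q i j)
  east : ∀ i ≤ b, ∀ j < a, q i j ∉ Y
  fwd_eq : ∀ i ≤ b, ∀ j < a, E.fwd (q i j) = q i (j + 1)
  north : ∀ i < b, ∀ j ≤ a, E.rot (q i j) ∉ Y
  up_eq : ∀ i < b, ∀ j ≤ a, E.up (q i j) = q (i + 1) j
  eastWall : ∀ i ≤ b, q i a ∈ Y
  westWall : ∀ i ≤ b, E.rot (E.rot (q i 0)) ∈ Y
  northWall : ∀ j ≤ a, E.rot (q b j) ∈ Y
  southWall : ∀ j ≤ a, E.rot (E.rot (E.rot (q 0 j))) ∈ Y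

/-- The dart `p` leaves the south-west corner to the east; `a` and `b` count the steps east and
north before a wall. Flatness transfers a row to the one above it: the squares close up, and the
side walls continue. In a row either all north edges are walls or none, so the first column decides
how high the grid reaches. -/
theorem IsFlat.isGrid {Y : Set D} (hY : E.IsFlat Y) {p : D} {a b : ℕ} (hp : E.AtCrossing p)
    (hw : E.rot (E.rot p) ∈ Y) (hs : E.rot (E.rot (E.rot p)) ∈ Y)
    (ha : (E.fwd)^[a] p ∈ Y) (ha' : ∀ j < a, (E.fwd)^[j] p ∉ Y)
    (hb : (E.fwd)^[b] (E.rot p) ∈ Y) (hb' : ∀ j < b, (E.fwd)^[j] (E.rot p) ∉ Y) :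
    E.IsGrid Y a b (fun i j => (E.up)^[i] ((E.fwd)^[j] p)) := by
  have hcol : ∀ i, E.rot ((E.up)^[i] p) = (E.fwd)^[i] (E.rot p) := by
    intro i
    induction i with
    | zero => rfl
    | succ i ih => rw [Function.iterate_succ_apply', Function.iterate_succ_apply', rot_up, ih]
  -- the statement for one row
  have row : ∀ i ≤ b,
      (∀ j < a, (E.up)^[i] ((E.fwd)^[j] p) ∉ Y) ∧
      (∀ j < a, E.fwd ((E.up)^[i] ((E.fwd)^[j] p)) = (E.up)^[i] ((E.fwd)^[j + 1] p)) ∧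
      (E.up)^[i] ((E.fwd)^[a] p) ∈ Y ∧ E.rot (E.rot ((E.up)^[i] p)) ∈ Y ∧
      (∀ j ≤ a, E.AtCrossing ((E.up)^[i] ((E.fwd)^[j] p))) ∧
      (∀ j ≤ a, (E.rot ((E.up)^[i] ((E.fwd)^[j] p)) ∈ Y ↔ E.rot ((E.up)^[i] p) ∈ Y)) := by
    have hnorth : ∀ i, (∀ j < a, (E.up)^[i] ((E.fwd)^[j] p) ∉ Y) →
        (∀ j < a, E.fwd ((E.up)^[i] ((E.fwd)^[j] p)) = (E.up)^[i] ((E.fwd)^[j + 1] p)) →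
        E.AtCrossing ((E.up)^[i] p) →
        (∀ j ≤ a, E.AtCrossing ((E.up)^[i] ((E.fwd)^[j] p)) ∧
          (E.rot ((E.up)^[i] ((E.fwd)^[j] p)) ∈ Y ↔ E.rot ((E.up)^[i] p) ∈ Y)) := by
      intro i h1 h2 h3 j
      induction j with
      | zero => exact fun _ => ⟨h3, Iff.rfl⟩
      | succ j ih =>
        intro hj
        obtain ⟨-, ih⟩ := ih (by omega)
        rw [← h2 j (by omega), ← ih, hY.north_iff (h1 j (by omega))]
        exact ⟨hY.atCrossing_fwd (h1 j (by omega)), Iff.rfl⟩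
    intro i
    induction i with
    | zero =>
      intro _
      have h2 : ∀ j < a, E.fwd ((E.up)^[0] ((E.fwd)^[j] p)) = (E.up)^[0] ((E.fwd)^[j + 1] p) := by
        intro j _
        simp [Function.iterate_succ_apply']
      have := hnorth 0 ha' h2 hp
      exact ⟨ha', h2, ha, hw, fun j hj => (this j hj).1, fun j hj => (this j hj).2⟩
    | succ i ih =>
      intro hi
      obtain ⟨e, f, w, ww, -, n⟩ := ih (by omega)
      have hn0 : E.rot ((E.up)^[i] p) ∉ Y := by
        rw [hcol]
        exact hb' i (by omega)
      have hn : ∀ j ≤ a, E.rot ((E.up)^[i] ((E.fwd)^[j] p)) ∉ Y := fun j hj => by rwa [n j hj]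
      have e' : ∀ j < a, (E.up)^[i + 1] ((E.fwd)^[j] p) ∉ Y := fun j hj => by
        rw [Function.iterate_succ_apply']
        exact (hY.flat _ (e j hj) (hn j hj.le)).2.1
      have f' : ∀ j < a, E.fwd ((E.up)^[i + 1] ((E.fwd)^[j] p)) =
          (E.up)^[i + 1] ((E.fwd)^[j + 1] p) := fun j hj => by
        rw [Function.iterate_succ_apply', Function.iterate_succ_apply' (f := E.up), ← f j hj]
        exact (hY.flat _ (e j hj) (hn j hj.le)).2.2.1
      have c' : E.AtCrossing ((E.up)^[i + 1] p) := by
        rw [← atCrossing_rot, Function.iterate_succ_apply', rot_up]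
        exact hY.atCrossing_fwd hn0
      have := hnorth _ e' f' c'
      refine ⟨e', f', ?_, ?_, fun j hj => (this j hj).1, fun j hj => (this j hj).2⟩
      · rw [Function.iterate_succ_apply']
        exact (hY.east_iff (hn a le_rfl)).1 w
      · rw [Function.iterate_succ_apply']
        exact (hY.west_iff hn0).1 ww
  have hsouth : ∀ j ≤ a, E.rot (E.rot (E.rot ((E.fwd)^[j] p))) ∈ Y := by
    intro j
    induction j with
    | zero => exact fun _ => hs
    | succ j ih =>
      intro hj
      rw [Function.iterate_succ_apply']
      exact (hY.south_iff (ha' j (by omega))).1 (ih (by omega))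
  exact
    { cross := fun i hi => (row i hi).2.2.2.2.1
      east := fun i hi => (row i hi).1
      fwd_eq := fun i hi => (row i hi).2.1
      north := fun i hi j hj => by
        rw [(row i hi.le).2.2.2.2.2 j hj, hcol]
        exact hb' i hi
      up_eq := fun i _ j _ => (Function.iterate_succ_apply' _ _ _).symm
      eastWall := fun i hi => (row i hi).2.2.1
      westWall := fun i hi => (row i hi).2.2.2.1
      northWall := fun j hj => by
        rw [(row b le_rfl).2.2.2.2.2 j hj, hcol]
        exact hb
      southWall := hsouth }

namespace IsGrid

variable {Y : Set D} {a b : ℕ} {q : ℕ → ℕ → D} (hq : E.IsGrid Y a b q)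
include hq

theorem rev_eq {i j : ℕ} (hi : i ≤ b) (hj : j < a) :
    E.rev (q i j) = E.rot (E.rot (q i (j + 1))) := by
  rw [← hq.fwd_eq i hi j hj, rot_rot_fwd]

theorem rev_rot_eq {i j : ℕ} (hi : i < b) (hj : j ≤ a) :
    E.rev (E.rot (q i j)) = E.rot (E.rot (E.rot (q (i + 1) j))) := by
  rw [← hq.up_eq i hi j hj, rot_up, rot_rot_fwd]

/-- The grid turned by a right angle. -/
theorem turn (hY : E.IsFlat Y) :
    E.IsGrid Y b a (fun i j => E.rot (q j (a - i))) where
  cross i hi j hj := by rw [atCrossing_rot]; exact hq.cross _ hj _ (by omega)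
  east i hi j hj := hq.north j hj _ (by omega)
  fwd_eq i hi j hj := by
    rw [← rot_up, hq.up_eq j hj _ (by omega)]
  north i hi j hj := by
    have h : a - i = (a - (i + 1)) + 1 := by omega
    rw [h, ← hq.rev_eq hj (by omega), hY.rev_mem]
    exact hq.east j hj _ (by omega)
  up_eq i hi j hj := by
    have h : a - i = (a - (i + 1)) + 1 := by omega
    rw [h, up, ← hq.rev_eq hj (by omega), E.rev_rev]
  eastWall i hi := hq.northWall _ (by omega)
  westWall i hi := hq.southWall _ (by omega)
  northWall j hj := by
    rw [Nat.sub_self]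
    exact hq.westWall j hj
  southWall j hj := by
    rw [E.rot_four, Nat.sub_zero]
    exact hq.eastWall j hj

theorem sameCycle_row {i j j' : ℕ} (hi : i ≤ b) (hj : j ≤ a) (hj' : j' ≤ a) :
    E.fwd.SameCycle (q i j) (q i j') := by
  have key : ∀ j ≤ a, E.fwd.SameCycle (q i 0) (q i j) := by
    intro j
    induction j with
    | zero => exact fun _ => Equiv.Perm.SameCycle.refl _ _
    | succ j ih =>
      intro hj
      rw [← hq.fwd_eq i hi j (by omega)]
      exact (ih (by omega)).trans (E.sameCycle_fwd _)
  exact (key j hj).symm.trans (key j' hj')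

theorem sameCycle_col {i i' j : ℕ} (hi : i ≤ b) (hi' : i' ≤ b) (hj : j ≤ a) :
    E.fwd.SameCycle (E.rot (q i j)) (E.rot (q i' j)) := by
  have key : ∀ i ≤ b, E.fwd.SameCycle (E.rot (q 0 j)) (E.rot (q i j)) := by
    intro i
    induction i with
    | zero => exact fun _ => Equiv.Perm.SameCycle.refl _ _
    | succ i ih =>
      intro hi
      rw [← hq.up_eq i (by omega) j hj, rot_up]
      exact (ih (by omega)).trans (E.sameCycle_fwd _)
  exact (key i hi).symm.trans (key i' hi')

/-- Rows and columns run along strings. If the grid met itself after a quarter turn, a row and a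
column through a common square would belong to one string, which would cross itself there. -/
theorem ne_rot {i j i' j' : ℕ} (hi : i ≤ b) (hj : j ≤ a) (hi' : i' ≤ b) (hj' : j' ≤ a) :
    q i j ≠ E.rot (q i' j') := by
  intro h
  apply E.not_sameCycle_rot (hq.cross i hi j' hj')
  have h1 := hq.sameCycle_row hi hj' hj
  rw [h] at h1
  exact h1.trans (hq.sameCycle_col hi' hi hj')

theorem iterate_fwd {i j k : ℕ} (hi : i ≤ b) (hj : j + k ≤ a) :
    (E.fwd)^[k] (q i j) = q i (j + k) := by
  induction k with
  | zero => rfl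
  | succ k ih =>
    rw [Function.iterate_succ_apply', ih (by omega), hq.fwd_eq i hi _ (by omega)]
    rfl

/-- Walking east from the common dart, the wall is hit after `a - j'` steps by the second
description, while by the first no wall comes before step `a - j`. -/
theorem col_le_of_eq {i j i' j' : ℕ} (hi : i ≤ b) (hi' : i' ≤ b) (hj' : j' ≤ a)
    (h : q i j = q i' j') : j' ≤ j := by
  by_contra hlt
  have h1 := hq.iterate_fwd (k := a - j') hi' (by omega : j' + (a - j') ≤ a)
  rw [← h, hq.iterate_fwd hi (by omega)] at h1
  apply hq.east i hi (j + (a - j')) (by omega)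
  rw [h1, Nat.add_sub_cancel' hj']
  exact hq.eastWall i' hi'

theorem row_le_of_eq (hY : E.IsFlat Y) {i j i' j' : ℕ} (hj : j ≤ a) (hi' : i' ≤ b)
    (hj' : j' ≤ a) (h : q i j = q i' j') : i' ≤ i := by
  have := (hq.turn hY).col_le_of_eq (i := a - j) (i' := a - j') (j := i) (j' := i')
    (by omega) (by omega) hi'
  apply this
  rw [Nat.sub_sub_self hj, Nat.sub_sub_self hj', h]

/-- If a grid overlaps with itself upside down, then so it does when the columns are shifted. -/
theorem flip_step {i j i' j' : ℕ} (hi : i ≤ b) (hj : j < a) (hi' : i' ≤ b) (hj' : j' < a)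
    (h : q i j = E.rot (E.rot (q i' (j' + 1)))) :
    q i (j + 1) = E.rot (E.rot (q i' j')) := by
  rw [← hq.fwd_eq i hi j hj, h, ← hq.rev_eq hi' hj', fwd_apply, E.rev_rev]

/-- Both columns move towards each other, one step each, until they coincide or are adjacent; `k`
only bounds the induction. -/
theorem flip_center {i i' : ℕ} (hi : i ≤ b) (hi' : i' ≤ b) (k : ℕ) :
    ∀ {j j' : ℕ}, j' - j ≤ k → j ≤ j' → j' ≤ a → q i j = E.rot (E.rot (q i' j')) →
    ∃ c, (c ≤ a ∧ q i c = E.rot (E.rot (q i' c))) ∨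
      (c < a ∧ q i c = E.rot (E.rot (q i' (c + 1)))) := by
  induction k with
  | zero =>
    intro j j' h1 h2 h3 h
    obtain rfl : j = j' := by omega
    exact ⟨j, Or.inl ⟨h3, h⟩⟩
  | succ k ih =>
    intro j j' h1 h2 h3 h
    rcases Nat.lt_or_ge (j + 1) j' with h4 | h4
    · obtain ⟨l, rfl⟩ : ∃ l, j' = l + 1 := ⟨j' - 1, by omega⟩
      exact ih (by omega) (by omega) (by omega) (hq.flip_step hi (by omega) hi' (by omega) h)
    · rcases Nat.eq_or_lt_of_le h2 with rfl | h5
      · exact ⟨j, Or.inl ⟨h3, h⟩⟩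
      · obtain rfl : j' = j + 1 := by omega
        exact ⟨j, Or.inr ⟨by omega, h⟩⟩

omit hq in
theorem flip_symm {x y : D} (h : x = E.rot (E.rot y)) : y = E.rot (E.rot x) := by
  rw [h, E.rot_four]

/-- Some column, or pair of adjacent columns, overlaps with itself upside down. -/
theorem exists_flip_col {i j i' j' : ℕ} (hi : i ≤ b) (hj : j ≤ a) (hi' : i' ≤ b) (hj' : j' ≤ a)
    (h : q i j = E.rot (E.rot (q i' j'))) :
    ∃ i ≤ b, ∃ i' ≤ b, ∃ c, (c ≤ a ∧ q i c = E.rot (E.rot (q i' c))) ∨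
      (c < a ∧ q i c = E.rot (E.rot (q i' (c + 1)))) := by
  rcases le_total j j' with h1 | h1
  · exact ⟨i, hi, i', hi', hq.flip_center hi hi' _ le_rfl h1 hj' h⟩
  · exact ⟨i', hi', i, hi, hq.flip_center hi' hi _ le_rfl h1 hj (flip_symm h)⟩

theorem flip_step_up {i j i' j' : ℕ} (hi : i < b) (hj : j ≤ a) (hi' : i' < b) (hj' : j' ≤ a)
    (h : q i j = E.rot (E.rot (q (i' + 1) j'))) :
    q (i + 1) j = E.rot (E.rot (q i' j')) := by
  rw [← hq.up_eq i hi j hj, h, up, ← hq.rev_rot_eq hi' hj', E.rev_rev]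

theorem flip_center_up {c c' : ℕ} (hc : c ≤ a) (hc' : c' ≤ a) (k : ℕ) :
    ∀ {i i' : ℕ}, i' - i ≤ k → i ≤ i' → i' ≤ b → q i c = E.rot (E.rot (q i' c')) →
    ∃ i, (i ≤ b ∧ q i c = E.rot (E.rot (q i c'))) ∨
      (i < b ∧ q i c = E.rot (E.rot (q (i + 1) c'))) := by
  induction k with
  | zero =>
    intro i i' h1 h2 h3 h
    obtain rfl : i = i' := by omega
    exact ⟨i, Or.inl ⟨h3, h⟩⟩
  | succ k ih =>
    intro i i' h1 h2 h3 h
    rcases Nat.lt_or_ge (i + 1) i' with h4 | h4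
    · obtain ⟨l, rfl⟩ : ∃ l, i' = l + 1 := ⟨i' - 1, by omega⟩
      exact ih (by omega) (by omega) (by omega) (hq.flip_step_up (by omega) hc (by omega) hc' h)
    · rcases Nat.eq_or_lt_of_le h2 with rfl | h5
      · exact ⟨i, Or.inl ⟨h3, h⟩⟩
      · obtain rfl : i' = i + 1 := by omega
        exact ⟨i, Or.inr ⟨by omega, h⟩⟩

/-- A half turn of the grid onto itself has a centre, found by moving the two positions together
horizontally and then vertically. It is the centre of a square, the midpoint of an edge or a net
vertex, and each is impossible. -/
theorem ne_rot_rot (hY : E.IsFlat Y) {i j i' j' : ℕ} (hi : i ≤ b) (hj : j ≤ a) (hi' : i' ≤ b)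
    (hj' : j' ≤ a) : q i j ≠ E.rot (E.rot (q i' j')) := by
  intro h
  -- a square that is its own image
  have center : ∀ i ≤ b, ∀ c ≤ a, q i c ≠ E.rot (E.rot (q i c)) :=
    fun i hi c hc h => E.rot_rot_ne (hq.cross i hi c hc) h.symm
  have vert : ∀ i < b, ∀ c ≤ a, q i c ≠ E.rot (E.rot (q (i + 1) c)) := by
    intro i hi c hc h
    apply E.rev_ne (E.rot (q i c))
    rw [hq.rev_rot_eq hi hc, ← h]
  have horiz : ∀ i ≤ b, ∀ c < a, q i c ≠ E.rot (E.rot (q i (c + 1))) := by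
    intro i hi c hc h
    apply E.rev_ne (q i c)
    rw [hq.rev_eq hi hc, ← h]
  -- A half turn about a net vertex would give it degree 2; the last clause of `flat` is there to
  -- exclude this.
  have diag : ∀ i < b, ∀ c < a, q (i + 1) c ≠ E.rot (E.rot (q i (c + 1))) := by
    intro i hi c hc h
    apply (hY.flat _ (hq.east i hi.le c hc) (hq.north i hi c hc.le)).2.2.2
    rw [hq.fwd_eq i hi.le c hc, hq.rev_rot_eq hi hc.le, h, E.rot_four]
  obtain ⟨i, hi, i', hi', c, ⟨hc, h⟩ | ⟨hc, h⟩⟩ := hq.exists_flip_col hi hj hi' hj' h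
  · rcases le_total i i' with h1 | h1
    · obtain ⟨i, ⟨hi, h⟩ | ⟨hi, h⟩⟩ := hq.flip_center_up hc hc _ le_rfl h1 hi' h
      · exact center i hi c hc h
      · exact vert i hi c hc h
    · obtain ⟨i, ⟨hi, h⟩ | ⟨hi, h⟩⟩ := hq.flip_center_up hc hc _ le_rfl h1 hi (flip_symm h)
      · exact center i hi c hc h
      · exact vert i hi c hc h
  · rcases le_total i i' with h1 | h1
    · obtain ⟨i, ⟨hi, h⟩ | ⟨hi, h⟩⟩ := hq.flip_center_up hc.le hc _ le_rfl h1 hi' h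
      · exact horiz i hi c hc h
      · exact diag i hi c hc (hq.flip_step_up hi hc.le hi hc h)
    · obtain ⟨i, ⟨hi, h⟩ | ⟨hi, h⟩⟩ := hq.flip_center_up hc hc.le _ le_rfl h1 hi (flip_symm h)
      · exact horiz i hi c hc (flip_symm h)
      · exact diag i hi c hc (flip_symm h)

theorem vertex_injective [Finite D] (hY : E.IsFlat Y) {i j i' j' : ℕ} (hi : i ≤ b) (hj : j ≤ a)
    (hi' : i' ≤ b) (hj' : j' ≤ a) (h : E.vertex (q i j) = E.vertex (q i' j')) :
    i = i' ∧ j = j' := by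
  rcases E.vertex_eq_iff.1 h with h | h | h | h
  · exact ⟨le_antisymm (hq.row_le_of_eq hY hj' hi hj h.symm)
      (hq.row_le_of_eq hY hj hi' hj' h), le_antisymm
      (hq.col_le_of_eq hi' hi hj h.symm) (hq.col_le_of_eq hi hi' hj' h)⟩
  · exact (hq.ne_rot hi hj hi' hj' h).elim
  · exact (hq.ne_rot_rot hY hi hj hi' hj' h).elim
  · refine (hq.ne_rot hi' hj' hi hj ?_).elim
    rw [h, E.rot_four]

end IsGrid

/-! ### Rectangles -/

/-- The rectangle with the given grid of squares. -/
def gridRect (E : StringSystem D) (n m : ℕ) (q : ℕ → ℕ → D) : E.Rect where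
  squares := {v | ∃ i < n, ∃ j < m, v = E.vertex (q i j)}
  inner := {d |
      (∃ i < n, ∃ j, j + 1 < m ∧ (d = q i j ∨ E.rev d = q i j)) ∨
      (∃ i, i + 1 < n ∧ ∃ j < m, (d = E.rot (q i j) ∨ E.rev d = E.rot (q i j)))}

/-- The grid condition in the definition of a rectangle. -/
structure IsRectGrid (E : StringSystem D) (n m : ℕ) (q : ℕ → ℕ → D) : Prop where
  row_pos : 0 < n
  col_pos : 0 < m
  cross : ∀ i < n, ∀ j < m, E.AtCrossing (q i j)
  inj : ∀ i < n, ∀ j < m, ∀ i' < n, ∀ j' < m,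
    E.vertex (q i j) = E.vertex (q i' j') → i = i' ∧ j = j'
  rev_eq : ∀ i < n, ∀ j, j + 1 < m → E.rev (q i j) = E.rot (E.rot (q i (j + 1)))
  rev_rot_eq : ∀ i, i + 1 < n → ∀ j < m,
    E.rev (E.rot (q i j)) = E.rot (E.rot (E.rot (q (i + 1) j)))

theorem isRectangle_iff {r : E.Rect} :
    E.IsRectangle r ↔ ∃ n m q, E.IsRectGrid n m q ∧ r = E.gridRect n m q := by
  constructor
  · rintro ⟨n, m, q, h1, h2, h3, h4, h5, h6, h7, h8⟩
    exact ⟨n, m, q, ⟨h1, h2, h3, h4, h5, h6⟩, Rect.ext h7 h8⟩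
  · rintro ⟨n, m, q, h, rfl⟩
    exact ⟨n, m, q, h.row_pos, h.col_pos, h.cross, h.inj, h.rev_eq, h.rev_rot_eq, rfl, rfl⟩

theorem rev_eq_iff {d e : D} : E.rev d = e ↔ d = E.rev e := by
  constructor
  · rintro rfl; exact (E.rev_rev d).symm
  · rintro rfl; exact E.rev_rev e

namespace IsRectGrid

variable {n m : ℕ} {q : ℕ → ℕ → D} (hq : E.IsRectGrid n m q)
include hq

theorem mem_inner_iff {d : D} : d ∈ (E.gridRect n m q).inner ↔
    (∃ i < n, ∃ j, j + 1 < m ∧ (d = q i j ∨ d = E.rot (E.rot (q i (j + 1))))) ∨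
    (∃ i, i + 1 < n ∧ ∃ j < m, (d = E.rot (q i j) ∨
      d = E.rot (E.rot (E.rot (q (i + 1) j))))) := by
  refine or_congr ?_ ?_
  · refine exists_congr fun i => and_congr_right fun hi => exists_congr fun j =>
      and_congr_right fun hj => ?_
    rw [rev_eq_iff, hq.rev_eq i hi j hj]
  · refine exists_congr fun i => and_congr_right fun hi => exists_congr fun j =>
      and_congr_right fun hj => ?_
    rw [rev_eq_iff, hq.rev_rot_eq i hi j hj]

theorem rot_pow_inj {i j i' j' k k' : ℕ} (hi : i < n) (hj : j < m) (hi' : i' < n) (hj' : j' < m)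
    (hk : k < 4) (hk' : k' < 4) (h : (E.rot ^ k) (q i j) = (E.rot ^ k') (q i' j')) :
    i = i' ∧ j = j' ∧ k = k' := by
  have hv : ∀ (k : ℕ) (x : D), E.vertex ((E.rot ^ k) x) = E.vertex x := by
    intro k x
    induction k with
    | zero => rfl
    | succ k ih => rw [pow_succ', Equiv.Perm.mul_apply, vertex_rot, ih]
  have h1 := congrArg E.vertex h
  rw [hv, hv] at h1
  obtain ⟨rfl, rfl⟩ := hq.inj i hi j hj i' hi' j' hj' h1
  refine ⟨rfl, rfl, ?_⟩
  have hc := hq.cross i hi j hj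
  have e1 : E.rot (q i j) ≠ q i j := hc
  have e2 := E.rot_rot_ne hc
  have e3 := E.rot_rot_rot_ne hc
  interval_cases k <;> interval_cases k' <;> simp [pow_succ, eq_comm] at h ⊢ <;>
    first | exact e1 h | exact e1 h.symm | exact e2 h | exact e2 h.symm | exact e3 h |
      exact e3 h.symm

theorem mem_inner_pow_iff {i j k : ℕ} (hi : i < n) (hj : j < m) (hk : k < 4) :
    (E.rot ^ k) (q i j) ∈ (E.gridRect n m q).inner ↔
      (k = 0 ∧ j + 1 < m) ∨ (k = 1 ∧ i + 1 < n) ∨ (k = 2 ∧ 0 < j) ∨ (k = 3 ∧ 0 < i) := by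
  have h0 : ∀ x, x = (E.rot ^ 0) x := fun x => rfl
  have h1 : ∀ x, E.rot x = (E.rot ^ 1) x := fun x => rfl
  have h2 : ∀ x, E.rot (E.rot x) = (E.rot ^ 2) x := fun x => rfl
  have h3 : ∀ x, E.rot (E.rot (E.rot x)) = (E.rot ^ 3) x := fun x => rfl
  rw [hq.mem_inner_iff]
  constructor
  · rintro (⟨i', hi', j', hj', h | h⟩ | ⟨i', hi', j', hj', h | h⟩)
    · have := hq.rot_pow_inj (k' := 0) hi hj hi' (by omega) hk (by omega) h
      omega
    · have := hq.rot_pow_inj (k' := 2) hi hj hi' hj' hk (by omega) h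
      omega
    · have := hq.rot_pow_inj (k' := 1) hi hj (by omega) hj' hk (by omega) h
      omega
    · have := hq.rot_pow_inj (k' := 3) hi hj hi' hj' hk (by omega) h
      omega
  · rintro (⟨rfl, h⟩ | ⟨rfl, h⟩ | ⟨rfl, h⟩ | ⟨rfl, h⟩)
    · exact Or.inl ⟨i, hi, j, h, Or.inl rfl⟩
    · exact Or.inr ⟨i, h, j, hj, Or.inl rfl⟩
    · obtain ⟨l, rfl⟩ : ∃ l, j = l + 1 := ⟨j - 1, by omega⟩
      exact Or.inl ⟨i, hi, l, hj, Or.inr rfl⟩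
    · obtain ⟨l, rfl⟩ : ∃ l, i = l + 1 := ⟨i - 1, by omega⟩
      exact Or.inr ⟨l, hi, j, hj, Or.inr rfl⟩

omit hq in
theorem exists_of_vertex_mem [Finite D] {d : D} (h : E.vertex d ∈ (E.gridRect n m q).squares) :
    ∃ i < n, ∃ j < m, ∃ k < 4, d = (E.rot ^ k) (q i j) := by
  obtain ⟨i, hi, j, hj, h⟩ := h
  refine ⟨i, hi, j, hj, ?_⟩
  rcases E.vertex_eq_iff.1 h with rfl | rfl | rfl | rfl
  exacts [⟨0, by omega, rfl⟩, ⟨1, by omega, rfl⟩, ⟨2, by omega, rfl⟩, ⟨3, by omega, rfl⟩]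

theorem vertex_mem_of_inner {d : D} (h : d ∈ (E.gridRect n m q).inner) :
    E.vertex d ∈ (E.gridRect n m q).squares := by
  rw [hq.mem_inner_iff] at h
  rcases h with ⟨i, hi, j, hj, rfl | rfl⟩ | ⟨i, hi, j, hj, rfl | rfl⟩
  · exact ⟨i, hi, j, by omega, rfl⟩
  · exact ⟨i, hi, j + 1, hj, by simp only [vertex_rot]⟩
  · exact ⟨i, by omega, j, hj, by simp only [vertex_rot]⟩
  · exact ⟨i + 1, hi, j, hj, by simp only [vertex_rot]⟩

/-- A rectangle is connected through its inner edges: move along the row to column 0, then down to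
the corner. -/
theorem squares_subset {A : Set E.Vertex}
    (hA : ∀ d ∈ (E.gridRect n m q).inner, E.vertex d ∈ A → E.vertex (E.rev d) ∈ A)
    {v : E.Vertex} (hv : v ∈ (E.gridRect n m q).squares) (hvA : v ∈ A) :
    (E.gridRect n m q).squares ⊆ A := by
  have hrow : ∀ i < n, ∀ j, j + 1 < m → (E.vertex (q i j) ∈ A ↔ E.vertex (q i (j + 1)) ∈ A) := by
    intro i hi j hj
    have h1 : E.vertex (E.rev (q i j)) = E.vertex (q i (j + 1)) := by
      rw [hq.rev_eq i hi j hj]; simp only [vertex_rot]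
    constructor
    · intro h
      rw [← h1]
      exact hA _ (Or.inl ⟨i, hi, j, hj, Or.inl rfl⟩) h
    · intro h
      have := hA (E.rev (q i j)) (Or.inl ⟨i, hi, j, hj, Or.inr (E.rev_rev _)⟩) (by rwa [h1])
      rwa [E.rev_rev] at this
  have hcol : ∀ i, i + 1 < n → ∀ j < m, (E.vertex (q i j) ∈ A ↔ E.vertex (q (i + 1) j) ∈ A) := by
    intro i hi j hj
    have h1 : E.vertex (E.rev (E.rot (q i j))) = E.vertex (q (i + 1) j) := by
      rw [hq.rev_rot_eq i hi j hj]; simp only [vertex_rot]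
    constructor
    · intro h
      rw [← h1]
      exact hA _ (Or.inr ⟨i, hi, j, hj, Or.inl rfl⟩) (by rwa [vertex_rot])
    · intro h
      have := hA (E.rev (E.rot (q i j))) (Or.inr ⟨i, hi, j, hj, Or.inr (E.rev_rev _)⟩)
        (by rwa [h1])
      rwa [E.rev_rev, vertex_rot] at this
  have hrow' : ∀ i < n, ∀ j < m, (E.vertex (q i j) ∈ A ↔ E.vertex (q i 0) ∈ A) := by
    intro i hi j
    induction j with
    | zero => exact fun _ => Iff.rfl
    | succ j ih => exact fun hj => (hrow i hi j hj).symm.trans (ih (by omega))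
  have hcol' : ∀ i < n, (E.vertex (q i 0) ∈ A ↔ E.vertex (q 0 0) ∈ A) := by
    intro i
    induction i with
    | zero => exact fun _ => Iff.rfl
    | succ i ih => exact fun hi => (hcol i hi 0 hq.col_pos).symm.trans (ih (by omega))
  obtain ⟨i, hi, j, hj, rfl⟩ := hv
  rintro _ ⟨i', hi', j', hj', rfl⟩
  rw [hrow' _ hi' _ hj', hcol' _ hi']
  rwa [hrow' _ hi _ hj, hcol' _ hi] at hvA

/-- Two consecutive inner edges at a square of a grid span a vertex of degree 4 inside the grid. -/
theorem flat {x : D} (hx : x ∈ (E.gridRect n m q).inner)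
    (hx' : E.rot x ∈ (E.gridRect n m q).inner) [Finite D] :
    E.rot (E.fwd x) ∈ (E.gridRect n m q).inner ∧ E.up x ∈ (E.gridRect n m q).inner ∧
      E.fwd (E.up x) = E.up (E.fwd x) ∧ E.rot (E.fwd x) ≠ E.rev (E.rot x) := by
  have r0 : ∀ {i j}, i < n → j + 1 < m → E.rev (q i j) = E.rot (E.rot (q i (j + 1))) :=
    fun hi hj => hq.rev_eq _ hi _ hj
  have r1 : ∀ {i j}, i + 1 < n → j < m →
    E.rev (E.rot (q i j)) = E.rot (E.rot (E.rot (q (i + 1) j))) :=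
    fun hi hj => hq.rev_rot_eq _ hi _ hj
  have r2 : ∀ {i j}, i < n → j + 1 < m → E.rev (E.rot (E.rot (q i (j + 1)))) = q i j :=
    fun hi hj => by rw [← r0 hi hj, E.rev_rev]
  have r3 : ∀ {i j}, i + 1 < n → j < m → E.rev (E.rot (E.rot (E.rot (q (i + 1) j)))) =
    E.rot (q i j) :=
    fun hi hj => by rw [← r1 hi hj, E.rev_rev]
  have mem0 := fun {i j} (hi : i < n) (hj : j < m) => hq.mem_inner_pow_iff (k := 0) hi hj (by omega)
  have mem1 := fun {i j} (hi : i < n) (hj : j < m) => hq.mem_inner_pow_iff (k := 1) hi hj (by omega)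
  have mem2 := fun {i j} (hi : i < n) (hj : j < m) => hq.mem_inner_pow_iff (k := 2) hi hj (by omega)
  have mem3 := fun {i j} (hi : i < n) (hj : j < m) => hq.mem_inner_pow_iff (k := 3) hi hj (by omega)
  simp [pow_succ] at mem0 mem1 mem2 mem3
  have hne : ∀ {x y : D}, E.vertex x ≠ E.vertex y → x ≠ y := fun h h' => h (by rw [h'])
  obtain ⟨i, hi, j, hj, k, hk, rfl⟩ := exists_of_vertex_mem (hq.vertex_mem_of_inner hx)
  -- One case for each direction of `x`: the spanned vertex lies to the north-east, north-west,
  -- south-west or south-east of the square. The inequality holds because its two sides start at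
  -- diagonally opposite squares.
  interval_cases k <;> simp [pow_succ, E.rot_four] at hx hx'
  · rw [mem0 hi hj] at hx
    rw [mem1 hi hj] at hx'
    simp only [pow_zero, Equiv.Perm.one_apply]
    simp only [fwd_apply, up, r0 hi hx, E.rot_four, r1 hx' hj, r1 hx' hx, r0 hx' hx, mem0 hx' hj,
      mem1 hi hx]
    refine ⟨hx', hx, trivial, hne ?_⟩
    simp only [vertex_rot]
    intro h
    have := hq.inj _ hi _ hx _ hx' _ hj h
    omega
  · rw [mem1 hi hj] at hx
    rw [mem2 hi hj] at hx'
    obtain ⟨l, rfl⟩ : ∃ l, j = l + 1 := ⟨j - 1, by omega⟩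
    have hl : l < m := by omega
    simp only [pow_one]
    simp only [fwd_apply, up, r1 hx hj, E.rot_four, r2 hi hj, r1 hx hl, r2 hx hj, mem2 hx hj,
      mem1 hi hl]
    refine ⟨hx', hx, trivial, hne ?_⟩
    simp only [vertex_rot]
    intro h
    have := hq.inj _ hx _ hj _ hi _ hl h
    omega
  · rw [mem2 hi hj] at hx
    rw [mem3 hi hj] at hx'
    obtain ⟨l, rfl⟩ : ∃ l, j = l + 1 := ⟨j - 1, by omega⟩
    obtain ⟨p, rfl⟩ : ∃ p, i = p + 1 := ⟨i - 1, by omega⟩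
    have hl : l < m := by omega
    have hp : p < n := by omega
    simp only [pow_succ, pow_zero, one_mul, Equiv.Perm.mul_apply]
    simp only [fwd_apply, up, r2 hi hj, r3 hi hl, r3 hi hj, r2 hp hj, mem3 hi hl,
      mem2 hp hj]
    refine ⟨hx', hx, trivial, hne ?_⟩
    simp only [vertex_rot]
    intro h
    have := hq.inj _ hi _ hl _ hp _ hj h
    omega
  · rw [mem3 hi hj] at hx
    rw [mem0 hi hj] at hx'
    obtain ⟨p, rfl⟩ : ∃ p, i = p + 1 := ⟨i - 1, by omega⟩
    have hp : p < n := by omega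
    simp only [pow_succ, pow_zero, one_mul, Equiv.Perm.mul_apply]
    simp only [fwd_apply, up, r3 hi hj, E.rot_four, r0 hi hx', r3 hi hx', r0 hp hx', mem0 hp hj,
      mem3 hi hx']
    refine ⟨hx', hx, trivial, hne ?_⟩
    simp only [vertex_rot]
    intro h
    have := hq.inj _ hp _ hj _ hi _ hx' h
    omega

end IsRectGrid

/-! ### Blocks: the rectangles cut out by a flat edge set -/

/-- A rectangle whose inner edges are the edges not in `Y` at its squares. -/
structure IsBlock (E : StringSystem D) (Y : Set D) (r : E.Rect) : Prop where
  rect : E.IsRectangle r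
  inner_iff : ∀ d, E.vertex d ∈ r.squares → (d ∈ r.inner ↔ d ∉ Y)

theorem IsRectangle.vertex_mem {r : E.Rect} (hr : E.IsRectangle r) {d : D} (h : d ∈ r.inner) :
    E.vertex d ∈ r.squares := by
  obtain ⟨n, m, q, hq, rfl⟩ := isRectangle_iff.1 hr
  exact hq.vertex_mem_of_inner h

theorem IsRectangle.rev_mem {r : E.Rect} (hr : E.IsRectangle r) {d : D} (h : d ∈ r.inner) :
    E.rev d ∈ r.inner := by
  obtain ⟨n, m, q, hq, rfl⟩ := isRectangle_iff.1 hr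
  rcases h with ⟨i, hi, j, hj, h⟩ | ⟨i, hi, j, hj, h⟩
  · exact Or.inl ⟨i, hi, j, hj, by rw [E.rev_rev]; exact h.symm⟩
  · exact Or.inr ⟨i, hi, j, hj, by rw [E.rev_rev]; exact h.symm⟩

theorem IsRectangle.atCrossing [Finite D] {r : E.Rect} (hr : E.IsRectangle r) {d : D}
    (h : E.vertex d ∈ r.squares) : E.AtCrossing d := by
  obtain ⟨n, m, q, hq, rfl⟩ := isRectangle_iff.1 hr
  obtain ⟨i, hi, j, hj, h⟩ := h
  exact E.atCrossing_of_vertex_eq h.symm (hq.cross i hi j hj)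

theorem IsRectangle.exists_mem {r : E.Rect} (hr : E.IsRectangle r) :
    ∃ d, E.AtCrossing d ∧ E.vertex d ∈ r.squares := by
  obtain ⟨n, m, q, hq, rfl⟩ := isRectangle_iff.1 hr
  exact ⟨q 0 0, hq.cross 0 hq.row_pos 0 hq.col_pos, 0, hq.row_pos, 0, hq.col_pos, rfl⟩

theorem IsRectangle.not_isBorder [Finite D] {r : E.Rect} (hr : E.IsRectangle r) {d : D}
    (h : d ∈ r.inner) : ¬ E.IsBorder d := by
  rintro (h' | h')
  · exact hr.atCrossing (hr.vertex_mem h) h'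
  · exact hr.atCrossing (hr.vertex_mem (hr.rev_mem h)) h'

namespace IsBlock

variable {Y : Set D}

theorem squares_subset {r r' : E.Rect} (hr : E.IsBlock Y r) (hr' : E.IsBlock Y r') {v : E.Vertex}
    (hv : v ∈ r.squares) (hv' : v ∈ r'.squares) : r.squares ⊆ r'.squares := by
  have hinner : ∀ d ∈ r.inner, E.vertex d ∈ r'.squares → E.vertex (E.rev d) ∈ r'.squares := by
    intro d hd hd'
    have h1 : d ∉ Y := (hr.inner_iff d (hr.rect.vertex_mem hd)).1 hd
    exact hr'.rect.vertex_mem (hr'.rect.rev_mem ((hr'.inner_iff d hd').2 h1))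
  obtain ⟨n, m, q, hq, rfl⟩ := isRectangle_iff.1 hr.rect
  exact hq.squares_subset hinner hv hv'

theorem inner_subset {r r' : E.Rect} (hr : E.IsBlock Y r) (hr' : E.IsBlock Y r') {v : E.Vertex}
    (hv : v ∈ r.squares) (hv' : v ∈ r'.squares) : r.inner ⊆ r'.inner := by
  intro d hd
  have h := hr.rect.vertex_mem hd
  rw [hr'.inner_iff d (hr.squares_subset hr' hv hv' h)]
  exact (hr.inner_iff d h).1 hd

/-- The inner edges at a square are prescribed by `Y`, and a rectangle is connected through its
inner edges, so one common square forces the blocks to agree. -/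
theorem eq_of_mem {r r' : E.Rect} (hr : E.IsBlock Y r) (hr' : E.IsBlock Y r') {v : E.Vertex}
    (hv : v ∈ r.squares) (hv' : v ∈ r'.squares) : r = r' :=
  Rect.ext ((hr.squares_subset hr' hv hv').antisymm (hr'.squares_subset hr hv' hv))
    ((hr.inner_subset hr' hv hv').antisymm (hr'.inner_subset hr hv' hv))

end IsBlock

theorem IsGrid.isBlock [Finite D] {Y : Set D} (hY : E.IsFlat Y) {a b : ℕ} {q : ℕ → ℕ → D}
    (hq : E.IsGrid Y a b q) : E.IsBlock Y (E.gridRect (b + 1) (a + 1) q) := by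
  have hg : E.IsRectGrid (b + 1) (a + 1) q :=
    { row_pos := by omega
      col_pos := by omega
      cross := fun i hi j hj => hq.cross i (by omega) j (by omega)
      inj := fun i hi j hj i' hi' j' hj' h =>
        hq.vertex_injective hY (by omega) (by omega) (by omega) (by omega) h
      rev_eq := fun i hi j hj => hq.rev_eq (by omega) (by omega)
      rev_rot_eq := fun i hi j hj => hq.rev_rot_eq (by omega) (by omega) }
  refine ⟨isRectangle_iff.2 ⟨_, _, q, hg, rfl⟩, fun d hd => ?_⟩
  obtain ⟨i, hi, j, hj, k, hk, rfl⟩ := IsRectGrid.exists_of_vertex_mem hd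
  rw [hg.mem_inner_pow_iff hi hj hk]
  interval_cases k <;> simp [pow_succ]
  · rcases Nat.lt_or_ge j a with h | h
    · simp [h, hq.east i (by omega) j h]
    · obtain rfl : j = a := by omega
      simp [hq.eastWall i (by omega)]
  · rcases Nat.lt_or_ge i b with h | h
    · simp [h, hq.north i h j (by omega)]
    · obtain rfl : i = b := by omega
      simp [hq.northWall j (by omega)]
  · rcases j with _ | j
    · simp [hq.westWall i (by omega)]
    · simp only [Nat.zero_lt_succ, true_iff]
      rw [← hq.rev_eq (by omega) (by omega), hY.rev_mem]
      exact hq.east i (by omega) j (by omega)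
  · rcases i with _ | i
    · simp [hq.southWall j (by omega)]
    · simp only [Nat.zero_lt_succ, true_iff]
      rw [← hq.rev_rot_eq (by omega) (by omega), hY.rev_mem]
      exact hq.north i (by omega) j (by omega)

/-- Turning round on a string and walking back retraces the same pieces in the opposite direction.
-/
theorem iterate_fwd_back {j k : ℕ} (h : j ≤ k) (y : D) :
    (E.fwd)^[j] (E.rot (E.rot ((E.fwd)^[k] y))) = E.rot (E.rot ((E.fwd)^[k - j] y)) := by
  induction j with
  | zero => rfl
  | succ j ih =>
    rw [Function.iterate_succ_apply', ih (by omega)]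
    obtain ⟨l, hl⟩ : ∃ l, k - j = l + 1 := ⟨k - j - 1, by omega⟩
    rw [hl, Function.iterate_succ_apply', fwd_rot_rot_fwd, show k - (j + 1) = l by omega]

namespace IsFlat

variable {Y : Set D} (hY : E.IsFlat Y)
include hY

/-- No string is closed, so the walk reaches an endpoint, and the pieces with endpoints are walls.
-/
theorem exists_wall [Finite D] (x : D) :
    ∃ k, (E.fwd)^[k] x ∈ Y ∧ ∀ j < k, (E.fwd)^[j] x ∉ Y := by
  classical
  have h : ∃ k, (E.fwd)^[k] x ∈ Y := by
    obtain ⟨k, hk⟩ := E.exists_iterate_fwd_atEnd x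
    exact ⟨k, hY.atEnd_mem _ hk⟩
  exact ⟨Nat.find h, Nat.find_spec h, fun j hj => Nat.find_min h hj⟩

theorem atCrossing_iterate_fwd {x : D} (hx : E.AtCrossing x) {k : ℕ}
    (hk : ∀ j < k, (E.fwd)^[j] x ∉ Y) : E.AtCrossing ((E.fwd)^[k] x) := by
  rcases k with _ | k
  · exact hx
  · rw [Function.iterate_succ_apply']
    exact hY.atCrossing_fwd (hk k (by omega))

/-- The first dart of the string through `x`, going backwards, behind which there is a wall. -/
theorem exists_start [Finite D] {x : D} (hx : E.AtCrossing x) :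
    ∃ k y, E.AtCrossing y ∧ E.rot (E.rot y) ∈ Y ∧ (E.fwd)^[k] y = x ∧
      ∀ j < k, (E.fwd)^[j] y ∉ Y := by
  obtain ⟨k, h1, h2⟩ := hY.exists_wall (E.rot (E.rot x))
  -- Walk from `x` in the opposite direction to the first wall and turn round there.
  refine ⟨k, E.rot (E.rot ((E.fwd)^[k] (E.rot (E.rot x)))), ?_, ?_, ?_, ?_⟩
  · rw [atCrossing_rot, atCrossing_rot]
    apply hY.atCrossing_iterate_fwd _ h2
    rwa [atCrossing_rot, atCrossing_rot]
  · rwa [E.rot_four]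
  · rw [iterate_fwd_back le_rfl, Nat.sub_self]
    exact E.rot_four x
  · intro j hj
    rw [iterate_fwd_back hj.le]
    obtain ⟨l, hl⟩ : ∃ l, k - j = l + 1 := ⟨k - j - 1, by omega⟩
    rw [hl, Function.iterate_succ_apply', rot_rot_fwd, hY.rev_mem]
    exact h2 l (by omega)

/-- Go west from `x` to a wall (`x'`), then south to a wall (`p`). The grid grown from the corner
`p` contains `x`, since no wall was met on the way. -/
theorem exists_block [Finite D] {x : D} (hx : E.AtCrossing x) :
    ∃ r, E.IsBlock Y r ∧ E.vertex x ∈ r.squares := by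
  obtain ⟨k, x', hx', hw, rfl, hk⟩ := hY.exists_start hx
  obtain ⟨l, y, hy, hs, hyx, hl⟩ := hY.exists_start ((E.atCrossing_rot).2 hx')
  obtain ⟨p, rfl⟩ : ∃ p, E.rot p = y := ⟨E.rot.symm y, by simp⟩
  have hcol : ∀ i, E.rot ((E.up)^[i] p) = (E.fwd)^[i] (E.rot p) := by
    intro i
    induction i with
    | zero => rfl
    | succ i ih => rw [Function.iterate_succ_apply', Function.iterate_succ_apply', rot_up, ih]
  have hup : (E.up)^[l] p = x' := E.rot.injective ((hcol l).trans hyx)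
  -- The wall to the west of `x'` continues down the column to `p`.
  have hw' : E.rot (E.rot p) ∈ Y := by
    have : ∀ i ≤ l, (E.rot (E.rot p) ∈ Y ↔ E.rot (E.rot ((E.up)^[i] p)) ∈ Y) := by
      intro i
      induction i with
      | zero => exact fun _ => Iff.rfl
      | succ i ih =>
        intro hi
        rw [ih (by omega), Function.iterate_succ_apply']
        apply hY.west_iff
        rw [hcol]
        exact hl i (by omega)
    rw [this l le_rfl, hup]
    exact hw
  obtain ⟨a, ha, ha'⟩ := hY.exists_wall p
  obtain ⟨b, hb, hb'⟩ := hY.exists_wall (E.rot p)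
  have hg := hY.isGrid (E.atCrossing_rot.1 hy) hw' hs ha ha' hb hb'
  have hlb : l ≤ b := by
    by_contra h
    exact hl b (by omega) hb
  have hiter : ∀ j ≤ a, (E.fwd)^[j] x' = (E.up)^[l] ((E.fwd)^[j] p) := by
    intro j hj
    have := hg.iterate_fwd (i := l) (j := 0) (k := j) hlb (by omega)
    simpa [hup] using this
  have hka : k ≤ a := by
    by_contra h
    apply hk a (by omega)
    rw [hiter a le_rfl]
    exact hg.eastWall l hlb
  refine ⟨_, hg.isBlock hY, l, by omega, k, by omega, ?_⟩
  rw [hiter k hka]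

end IsFlat

/-- The rectangulation into the blocks of an edge set. -/
theorem IsFlat.exists_rectangulation [Finite D] {Y : Set D} (hY : E.IsFlat Y) :
    ∃ R : Finset E.Rect, E.IsRectangulation R ∧ ∀ r, r ∈ R ↔ E.IsBlock Y r := by
  have : Finite E.Rect := by
    have : Function.Injective (fun r : E.Rect => (r.squares, r.inner)) := by
      intro r r' h
      exact Rect.ext (congrArg Prod.fst h) (congrArg Prod.snd h)
    exact Finite.of_injective _ this
  have hR : ∀ r, r ∈ (Set.toFinite {r | E.IsBlock Y r}).toFinset ↔ E.IsBlock Y r := by simp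
  refine ⟨_, ⟨fun r hr => ((hR r).1 hr).rect, fun d hd => ?_⟩, hR⟩
  obtain ⟨r, hr, hdr⟩ := hY.exists_block hd
  refine ⟨r, ⟨(hR r).2 hr, hdr⟩, ?_⟩
  rintro r' ⟨h1, h2⟩
  exact ((hR r').1 h1).eq_of_mem hr h2 hdr

/-! ### Delimiting cut-sets -/

/-- The edges of a set of segments together with the border. -/
def walls (E : StringSystem D) (S : Finset (List D)) : Set D := E.covered S ∪ {d | E.IsBorder d}

theorem rev_mem_covered {S : Finset (List D)} {d : D} :
    E.rev d ∈ E.covered S ↔ d ∈ E.covered S := by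
  simp [covered, E.rev_rev, or_comm]

theorem rev_mem_walls {S : Finset (List D)} {d : D} : E.rev d ∈ E.walls S ↔ d ∈ E.walls S :=
  or_congr rev_mem_covered E.isBorder_rev

/-- This trades the global condition on separating edges for a condition on each rectangle. The
hypothesis `hb` is needed because `IsCutSet` admits one-edge paths along the border, which separate
nothing. -/
theorem delimits_iff [Finite D] {S : Finset (List D)} {R : Finset E.Rect}
    (hR : E.IsRectangulation R) (hS : E.IsCutSet S)
    (hb : ∀ d ∈ E.covered S, ¬ E.IsBorder d) :
    E.Delimits S R ↔ ∀ r ∈ R, E.IsBlock (E.walls S) r := by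
  constructor
  · rintro ⟨-, h⟩ r hr
    refine ⟨hR.1 r hr, fun d hd => ⟨?_, ?_⟩⟩
    · rintro h1 (h2 | h2)
      · exact ((h d).1 h2).2 r hr h1
      · exact (hR.1 r hr).not_isBorder h1 h2
    · intro h1
      by_contra h2
      apply h1
      by_cases h3 : E.IsBorder d
      · exact Or.inr h3
      refine Or.inl ((h d).2 ⟨h3, fun r' hr' h4 => ?_⟩)
      have := (hR.2 d ((hR.1 r hr).atCrossing hd)).unique ⟨hr, hd⟩
        ⟨hr', (hR.1 r' hr').vertex_mem h4⟩
      exact h2 (this ▸ h4)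
  · intro h
    refine ⟨hS, fun d => ⟨fun hd => ⟨hb d hd, fun r hr h1 => ?_⟩, ?_⟩⟩
    · exact ((h r hr).inner_iff d ((hR.1 r hr).vertex_mem h1)).1 h1 (Or.inl hd)
    · rintro ⟨h1, h2⟩
      have hc : E.AtCrossing d := fun h' => h1 (Or.inl h')
      obtain ⟨r, ⟨hr, hd⟩, -⟩ := hR.2 d hc
      by_contra h3
      apply h2 r hr
      rw [(h r hr).inner_iff d hd]
      rintro (h4 | h4)
      exacts [h3 h4, h1 h4]

theorem Delimits.not_isBorder {S : Finset (List D)} {R : Finset E.Rect} (h : E.Delimits S R) {d : D}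
    (hd : d ∈ E.covered S) : ¬ E.IsBorder d :=
  ((h.2 d).1 hd).1

theorem Delimits.isBlock [Finite D] {S : Finset (List D)} {R : Finset E.Rect}
    (h : E.Delimits S R) (hR : E.IsRectangulation R) : ∀ r ∈ R, E.IsBlock (E.walls S) r :=
  (delimits_iff hR h.1 fun _ hd => h.not_isBorder hd).1 h

theorem eq_of_forall_isBlock {Y : Set D} {R R' : Finset E.Rect} (hR : E.IsRectangulation R)
    (hR' : E.IsRectangulation R') (h : ∀ r ∈ R, E.IsBlock Y r) (h' : ∀ r ∈ R', E.IsBlock Y r) :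
    R = R' := by
  have key : ∀ R R' : Finset E.Rect, E.IsRectangulation R → E.IsRectangulation R' →
      (∀ r ∈ R, E.IsBlock Y r) → (∀ r ∈ R', E.IsBlock Y r) → R ⊆ R' := by
    intro R R' hR hR' h h' r hr
    obtain ⟨d, hd, hdr⟩ := (hR.1 r hr).exists_mem
    obtain ⟨r', ⟨hr', hdr'⟩, -⟩ := hR'.2 d hd
    rwa [(h r hr).eq_of_mem (h' r' hr') hdr hdr']
  exact (key _ _ hR hR' h h').antisymm (key _ _ hR' hR h' h)

/-- Non-walls at a square are inner edges of its rectangle, so the condition is inherited from the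
grid. -/
theorem Delimits.isFlat [Finite D] {S : Finset (List D)} {R : Finset E.Rect}
    (h : E.Delimits S R) (hR : E.IsRectangulation R) : E.IsFlat (E.walls S) where
  rev_mem _ := rev_mem_walls
  atEnd_mem _ hd := Or.inr (Or.inl hd)
  flat x hx hx' := by
    have hc : E.AtCrossing x := fun h' => hx (Or.inr (Or.inl h'))
    obtain ⟨r, ⟨hr, hd⟩, -⟩ := hR.2 x hc
    have hb := h.isBlock hR r hr
    have h1 := (hb.inner_iff x hd).2 hx
    have h2 := (hb.inner_iff (E.rot x) (by rwa [vertex_rot])).2 hx'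
    obtain ⟨n, m, q, hq, rfl⟩ := isRectangle_iff.1 hb.rect
    have := hq.flat h1 h2
    refine ⟨?_, ?_, this.2.2⟩
    · exact (hb.inner_iff _ (hq.vertex_mem_of_inner this.1)).1 this.1
    · exact (hb.inner_iff _ (hq.vertex_mem_of_inner this.2.1)).1 this.2.1

/-- A block has four corners. -/
theorem IsBlock.ncard_corners [Finite D] {Y : Set D} {r : E.Rect} (hr : E.IsBlock Y r) :
    {e | E.vertex e ∈ r.squares ∧ e ∈ Y ∧ E.rot e ∈ Y}.ncard = 4 := by
  obtain ⟨n, m, q, hq, rfl⟩ := isRectangle_iff.1 hr.rect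
  have hn := hq.row_pos
  have hm := hq.col_pos
  -- For `k = 0, 1, 2, 3` the corner is the north-east, north-west, south-west and south-east one:
  -- there both the dart `rot ^ k` and the next one are walls. In a grid with a single row or column
  -- these squares may coincide, but the darts still differ in `k`.
  let i : ℕ → ℕ := fun k => if k = 0 ∨ k = 1 then n - 1 else 0
  let j : ℕ → ℕ := fun k => if k = 0 ∨ k = 3 then m - 1 else 0
  have hi : ∀ k, i k < n := fun k => by dsimp only [i]; split_ifs <;> omega
  have hj : ∀ k, j k < m := fun k => by dsimp only [j]; split_ifs <;> omega
  have hset : {e | E.vertex e ∈ (E.gridRect n m q).squares ∧ e ∈ Y ∧ E.rot e ∈ Y} =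
      (fun k => (E.rot ^ k) (q (i k) (j k))) '' Set.Iio 4 := by
    have hmem : ∀ i < n, ∀ j < m, ∀ k < 4, ((E.rot ^ k) (q i j) ∈ Y ↔
        ¬ ((k = 0 ∧ j + 1 < m) ∨ (k = 1 ∧ i + 1 < n) ∨ (k = 2 ∧ 0 < j) ∨ (k = 3 ∧ 0 < i))) := by
      intro i hi j hj k hk
      have hv : E.vertex ((E.rot ^ k) (q i j)) = E.vertex (q i j) := by
        interval_cases k <;> simp [pow_succ, vertex_rot]
      have := hr.inner_iff _ (hv ▸ ⟨i, hi, j, hj, rfl⟩ :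
        E.vertex ((E.rot ^ k) (q i j)) ∈ (E.gridRect n m q).squares)
      rw [hq.mem_inner_pow_iff hi hj hk] at this
      rw [this, not_not]
    have hrot : ∀ i < n, ∀ j < m, ∀ k < 4, (E.rot ((E.rot ^ k) (q i j)) ∈ Y ↔
        ¬ ((k = 3 ∧ j + 1 < m) ∨ (k = 0 ∧ i + 1 < n) ∨ (k = 1 ∧ 0 < j) ∨ (k = 2 ∧ 0 < i))) := by
      intro i hi j hj k hk
      rcases Nat.lt_or_ge k 3 with h | h
      · have := hmem i hi j hj (k + 1) (by omega)
        rw [pow_succ', Equiv.Perm.mul_apply] at this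
        rw [this]
        omega
      · obtain rfl : k = 3 := by omega
        have := hmem i hi j hj 0 (by omega)
        rw [show E.rot ((E.rot ^ 3) (q i j)) = (E.rot ^ 0) (q i j) from E.rot_four _, this]
        omega
    ext e
    constructor
    · rintro ⟨h1, h2, h3⟩
      obtain ⟨i', hi', j', hj', k, hk, rfl⟩ := IsRectGrid.exists_of_vertex_mem h1
      rw [hmem _ hi' _ hj' _ hk] at h2
      rw [hrot _ hi' _ hj' _ hk] at h3
      refine ⟨k, hk, ?_⟩
      have e1 : i k = i' := by dsimp only [i]; split_ifs <;> omega
      have e2 : j k = j' := by dsimp only [j]; split_ifs <;> omega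
      simp only [e1, e2]
    · rintro ⟨k, hk, rfl⟩
      have hk : k < 4 := hk
      refine ⟨?_, (hmem _ (hi k) _ (hj k) _ hk).2 ?_, (hrot _ (hi k) _ (hj k) _ hk).2 ?_⟩
      · refine ⟨i k, hi k, j k, hj k, ?_⟩
        dsimp only
        generalize q (i k) (j k) = x
        interval_cases k <;> simp [pow_succ, vertex_rot]
      · dsimp only [i, j]
        interval_cases k <;> simp <;> omega
      · dsimp only [i, j]
        interval_cases k <;> simp <;> omega
  rw [hset, Set.InjOn.ncard_image]
  · rw [Set.ncard_eq_toFinset_card']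
    simp
  · intro k hk k' hk' h
    exact (hq.rot_pow_inj (hi k) (hj k) (hi k') (hj k') hk hk' h).2.2

/-! ### Saturation -/

/-- The edges of `X`, in both directions, and of the border. -/
def thick (E : StringSystem D) (X : Set D) : Set D := {d | d ∈ X ∨ E.rev d ∈ X ∨ E.IsBorder d}

theorem thick_covered (S : Finset (List D)) : E.thick (E.covered S) = E.walls S := by
  ext d
  simp only [thick, walls, rev_mem_covered, Set.mem_ofPred_eq, Set.mem_union]
  tauto

/-- Every angle between consecutive darts at the cell `c` has a side in `Y`. -/
def Tight (E : StringSystem D) (Y : Set D) (c : E.Cell) : Prop :=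
  ∀ d, E.cell d = c → d ∈ Y ∨ E.next d ∈ Y

theorem Tight.mono {Y Y' : Set D} {c : E.Cell} (h : E.Tight Y c)
    (hYY' : ∀ d, E.cell d = c ∨ E.IsBorder d → d ∈ Y → d ∈ Y') : E.Tight Y' c := by
  intro d hd
  rcases h d hd with h' | h'
  · exact Or.inl (hYY' _ (Or.inl hd) h')
  · right
    by_cases hend : E.AtEnd (E.rev d)
    · exact hYY' _ (Or.inr (E.isBorder_next hend)) h'
    · exact hYY' _ (Or.inl ((E.cell_next hend).trans hd)) h'

/-- Once some wall starts at the cell, the condition that every angle sees at most two squares says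
that there are no two consecutive non-walls. -/
theorem tight_iff [Finite D] {Y : Set D} (hb : ∀ d, E.IsBorder d → d ∈ Y) {c : E.Cell} {e : D}
    (he : E.cell e = c) (heY : e ∈ Y) : E.Tight Y c ↔
      ∀ d, E.cell d = c → d ∈ Y → E.next d ∈ Y ∨ E.next (E.next d) ∈ Y := by
  constructor
  · intro h d hd hdY
    by_cases hend : E.AtEnd (E.rev d)
    · exact Or.inl (hb _ (E.isBorder_next hend))
    · exact h _ ((E.cell_next hend).trans hd)
  · intro h d hd
    -- The induction runs round the whole face, beyond the cell; the predicate is vacuous at other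
    -- cells, and just after an endpoint the dart is a border dart and so in `Y`.
    refine E.face_induction (P := fun d => E.cell d = c → d ∈ Y ∨ E.next d ∈ Y) ?_
      (fun _ => Or.inl heY) (E.face_eq_of_cell_eq (he.trans hd.symm)) hd
    intro d ih hd'
    by_cases hend : E.AtEnd (E.rev d)
    · exact Or.inl (hb _ (E.isBorder_next hend))
    · have hd := (E.cell_next hend).symm.trans hd'
      rcases ih hd with h1 | h1
      · exact h d hd h1
      · exact Or.inl h1

theorem Tight.exists_mem {Y : Set D} (hb : ∀ d, E.IsBorder d → d ∈ Y) {c : E.Cell}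
    (h : E.Tight Y c) : ∃ d, E.cell d = c ∧ d ∈ Y := by
  obtain ⟨d, hd⟩ := E.exists_cell_eq c
  rcases h d hd with h1 | h1
  · exact ⟨d, hd, h1⟩
  · by_cases hend : E.AtEnd (E.rev d)
    · exact ⟨d, hd, hb _ (Or.inr hend)⟩
    · exact ⟨_, (E.cell_next hend).trans hd, h1⟩

theorem saturates_iff [Finite D] {X : Set D} {c : E.Cell} : E.Saturates X c ↔
    (E.IsRegular c ∧ ∀ d, E.cell d = c → d ∉ E.thick X) ∨ E.Tight (E.thick X) c := by
  have hb : ∀ d, E.IsBorder d → d ∈ E.thick X := fun d hd => Or.inr (Or.inr hd)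
  refine or_congr Iff.rfl ⟨?_, ?_⟩
  · rintro ⟨⟨d, hd, hdY⟩, h⟩
    exact (tight_iff hb hd hdY).2 h
  · intro h
    obtain ⟨d, hd, hdY⟩ := h.exists_mem hb
    exact ⟨⟨d, hd, hdY⟩, (tight_iff hb hd hdY).1 h⟩

theorem saturates_iff_tight [Finite D] {X : Set D} {c : E.Cell} (hc : ¬ E.IsRegular c) :
    E.Saturates X c ↔ E.Tight (E.thick X) c := by
  rw [saturates_iff]
  exact or_iff_right fun h => hc h.1

/-- Extra walls only split angles. At a regular vertex this fails, since having no wall at all also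
counts as saturated there. -/
theorem Saturates.mono [Finite D] {X X' : Set D} {c : E.Cell} (h : E.Saturates X c)
    (hc : ¬ E.IsRegular c)
    (hX : ∀ d, E.cell d = c → ¬ E.IsBorder d → d ∈ E.thick X → d ∈ E.thick X') :
    E.Saturates X' c := by
  rw [saturates_iff_tight hc] at h ⊢
  refine h.mono fun d hd hdX => ?_
  by_cases hb : E.IsBorder d
  · exact Or.inr (Or.inr hb)
  · exact hX d (hd.resolve_right hb) hb hdX

theorem saturates_univ [Finite D] (c : E.Cell) : E.Saturates Set.univ c :=
  saturates_iff.2 (Or.inr fun _ _ => Or.inl (Or.inl trivial))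

theorem exists_saturates_card_eq_exponent [Finite D] (c : E.Cell) :
    ∃ X : Finset D, X.card = E.exponent c ∧ E.Saturates (X : Set D) c := by
  have : Fintype D := Fintype.ofFinite D
  have h : {k | ∃ X : Finset D, X.card = k ∧ E.Saturates (X : Set D) c}.Nonempty :=
    ⟨_, Finset.univ, rfl, by rw [Finset.coe_univ]; exact saturates_univ c⟩
  exact Nat.sInf_mem h

theorem exponent_le {c : E.Cell} {X : Finset D} (h : E.Saturates (X : Set D) c) :
    E.exponent c ≤ X.card :=
  Nat.sInf_le ⟨X, rfl, h⟩

theorem exponent_eq_zero_of_regular [Finite D] {c : E.Cell} (h : E.IsRegular c) :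
    E.exponent c = 0 := by
  have : E.Saturates ((∅ : Finset D) : Set D) c := by
    refine saturates_iff.2 (Or.inl ⟨h, fun d hd hdX => ?_⟩)
    rcases hdX with h1 | h1 | h1
    · simp at h1
    · simp at h1
    · exact h.1 d hd h1
  simpa using exponent_le this

theorem not_regular_of_exponent_pos [Finite D] {c : E.Cell} (h : 0 < E.exponent c) :
    ¬ E.IsRegular c := fun h' => by
  rw [exponent_eq_zero_of_regular h'] at h
  exact lt_irrefl _ h

/-- With `x` pointing east, these are consecutive darts of the net at the vertex to the north-east
of the tail of `x`. They translate between the rotation at squares and the rotation at net vertices.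
-/
theorem next_rot_fwd (x : D) :
    E.next (E.rev (E.rot x)) = x ∧ E.next x = E.rot (E.fwd x) ∧
      E.next (E.rot (E.fwd x)) = E.rot (E.rot (E.up (E.fwd x))) := by
  refine ⟨?_, ?_, ?_⟩
  · rw [next_apply, E.rev_rev, E.rot_four]
  · rw [next_apply, fwd_apply]
  · rw [next_apply, up]

/-- Two consecutive non-walls at a square are consecutive at a net vertex too, so that vertex is
saturated only by being regular and free of walls. Its four darts then close up. -/
theorem isFlat_of_saturates [Finite D] {S : Finset (List D)}
    (h : ∀ c, E.Saturates (E.covered S) c) : E.IsFlat (E.walls S) where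
  rev_mem _ := rev_mem_walls
  atEnd_mem _ hd := Or.inr (Or.inl hd)
  flat x hx hx' := by
    obtain ⟨n1, n2, n3⟩ := E.next_rot_fwd x
    have hd : E.rev (E.rot x) ∉ E.walls S := by rwa [rev_mem_walls]
    have hs := h (E.cell (E.rev (E.rot x)))
    rw [saturates_iff, thick_covered] at hs
    rcases hs with ⟨hr, hs⟩ | hs
    · have h1 : E.cell x = _ := n1 ▸ E.cell_next_of_regular hr
      have h2 : E.cell (E.rot (E.fwd x)) = _ := n2 ▸ (E.cell_next_of_regular (h1 ▸ hr)).trans h1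
      have h3 : E.cell (E.rot (E.rot (E.up (E.fwd x)))) = _ :=
        n3 ▸ (E.cell_next_of_regular (h2 ▸ hr)).trans h2
      have h4 := E.next_four hr
      rw [n1, n2, n3, next_apply] at h4
      have h5 : E.rev (E.rot (E.rot (E.up (E.fwd x)))) = E.up x := by
        have := congrArg E.rot h4
        rwa [E.rot_four] at this
      refine ⟨hs _ h2, ?_, ?_, ?_⟩
      · rw [← h5, rev_mem_walls]
        exact hs _ h3
      · rw [← h5, fwd_apply, E.rev_rev, E.rot_four]
      · have := E.next_two_ne hr
        rwa [n1, n2] at this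
    · rcases hs _ rfl with h1 | h1
      · exact (hd h1).elim
      · rw [n1] at h1
        exact (hx h1).elim

/-- Two consecutive darts not in a flat edge set start at a regular vertex without edges in the set. -/
theorem IsFlat.regular [Finite D] {Y : Set D} (hY : E.IsFlat Y) (hb : ∀ d, E.IsBorder d → d ∈ Y)
    {d : D} (h0 : d ∉ Y) (h1 : E.next d ∉ Y) :
    E.IsRegular (E.cell d) ∧ ∀ e, E.cell e = E.cell d → e ∉ Y := by
  obtain ⟨x, rfl⟩ : ∃ x, d = E.rev (E.rot x) :=
    ⟨E.rot.symm (E.rev d), by rw [Equiv.apply_symm_apply, E.rev_rev]⟩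
  obtain ⟨n1, n2, n3⟩ := E.next_rot_fwd x
  rw [n1] at h1
  rw [hY.rev_mem] at h0
  obtain ⟨f1, f2, f3, f4⟩ := hY.flat x h1 h0
  rw [← f3, rot_rot_fwd] at n3
  have n4 : E.next (E.rev (E.up x)) = E.rev (E.rot x) := by
    rw [next_apply, E.rev_rev, up, E.rot_four]
  have hr : E.IsRegular (E.cell (E.rev (E.rot x))) := by
    apply E.isRegular_of_next_four
    · rw [n1, n2, n3, n4]
    · rwa [n1, n2]
    · intro k hk hbk
      have := hb _ hbk
      interval_cases k <;> simp [n1, n2, n3, hY.rev_mem] at this <;> contradiction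
  refine ⟨hr, fun e he => ?_⟩
  rcases E.eq_of_cell_eq_regular hr he with rfl | rfl | rfl | rfl
  · rwa [hY.rev_mem]
  · rwa [n1]
  · rwa [n1, n2]
  · rwa [n1, n2, n3, hY.rev_mem]

theorem IsFlat.saturates [Finite D] {S : Finset (List D)} (h : E.IsFlat (E.walls S))
    (c : E.Cell) : E.Saturates (E.covered S) c := by
  rw [saturates_iff, thick_covered]
  by_contra hc
  rw [not_or] at hc
  apply hc.2
  intro d hd
  by_contra hd'
  rw [not_or] at hd'
  subst hd
  exact hc.1 (h.regular (fun _ h => Or.inr h) hd'.1 hd'.2)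

/-! ### Straight paths and cut-sets -/

theorem cell_straight {d : D} (h : E.IsRegular (E.cell (E.rev d))) :
    E.cell (E.straight d) = E.cell (E.rev d) := by
  have h1 := E.cell_next_of_regular h
  exact (E.cell_next_of_regular (h1 ▸ h)).trans h1

theorem exists_rel_of_mem_tail {α : Type*} {r : α → α → Prop} {x : α} :
    ∀ {s : List α}, s.IsChain r → x ∈ s.tail → ∃ y ∈ s, r y x
  | [], _, h => by simp at h
  | [_], _, h => by simp at h
  | a :: b :: l, hc, h => by
    rw [List.isChain_cons_cons] at hc
    rw [List.tail_cons, List.mem_cons] at h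
    rcases h with rfl | h
    · exact ⟨a, by simp, hc.1⟩
    · obtain ⟨y, hy, hr⟩ := exists_rel_of_mem_tail hc.2 h
      exact ⟨y, List.mem_cons_of_mem _ hy, hr⟩

theorem getLast_or_exists_rel {α : Type*} {r : α → α → Prop} {x : α} :
    ∀ {s : List α}, s.IsChain r → x ∈ s → s.getLast? = some x ∨ ∃ y ∈ s.tail, r x y
  | [], _, h => by simp at h
  | [_], _, h => by
    left
    simp at h
    simp [h]
  | a :: b :: l, hc, h => by
    rw [List.isChain_cons_cons] at hc
    rw [List.mem_cons] at h
    rcases h with rfl | h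
    · exact Or.inr ⟨b, by simp, hc.1⟩
    · rcases getLast_or_exists_rel hc.2 h with h | ⟨y, hy, hr⟩
      · left
        rw [List.getLast?_cons_cons, h]
      · exact Or.inr ⟨y, List.mem_of_mem_tail hy, hr⟩

theorem head_or_mem_tail {α : Type*} {x : α} {s : List α} (h : x ∈ s) :
    s.head? = some x ∨ x ∈ s.tail := by
  cases s with
  | nil => simp at h
  | cons a l =>
    rw [List.mem_cons] at h
    rcases h with rfl | h
    · exact Or.inl rfl
    · exact Or.inr h

theorem mem_inner_or_head {s : List D} {x : D} (hx : x ∈ s) :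
    s.head? = some x ∨ E.cell x ∈ E.innerVertices s :=
  (head_or_mem_tail hx).imp_right fun h => List.mem_map_of_mem h

namespace IsStraightPath

variable {s : List D} (hs : E.IsStraightPath s)
include hs

theorem regular_of_mem_inner {c : E.Cell} (hc : c ∈ E.innerVertices s) : E.IsRegular c := by
  obtain ⟨x, hx, rfl⟩ := List.mem_map.1 hc
  obtain ⟨y, -, hr, rfl⟩ := exists_rel_of_mem_tail hs.2.1 hx
  rwa [cell_straight hr]

theorem mem_inner_or_getLast {x : D} (hx : x ∈ s) :
    s.getLast? = some x ∨ E.cell (E.rev x) ∈ E.innerVertices s := by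
  rcases getLast_or_exists_rel hs.2.1 hx with h | ⟨y, hy, hr, rfl⟩
  · exact Or.inl h
  · right
    rw [← cell_straight hr]
    exact List.mem_map_of_mem hy

end IsStraightPath

namespace IsCutSet

variable {S : Finset (List D)} (hS : E.IsCutSet S)
include hS

/-- An end on a hole is not regular, and an end inside another segment cannot be an inner vertex
here, as segments do not pass through each other. So a segment never ends on its own interior. -/
theorem notMem_inner_of_validEnd {s : List D} (hs : s ∈ S) {c : E.Cell}
    (hc : E.IsValidEnd S s c) : c ∉ E.innerVertices s := by
  rintro h
  rcases hc with h1 | ⟨t, ht, hts, h1⟩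
  · exact h1 ((hS.1 s hs).regular_of_mem_inner h)
  · exact (hS.2.1 s hs t ht hts.symm).2 c h h1

theorem cell_head_notMem {s : List D} (hs : s ∈ S) {x : D} (hx : s.head? = some x) :
    E.cell x ∉ E.innerVertices s :=
  hS.notMem_inner_of_validEnd hs ((hS.2.2 s hs).1 x hx)

theorem cell_getLast_notMem {s : List D} (hs : s ∈ S) {x : D} (hx : s.getLast? = some x) :
    E.cell (E.rev x) ∉ E.innerVertices s :=
  hS.notMem_inner_of_validEnd hs ((hS.2.2 s hs).2 x hx)

theorem nodup {s : List D} (hs : s ∈ S) : s.Nodup := by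
  have h1 := (hS.1 s hs).2.2
  have h2 := fun x => hS.cell_head_notMem hs (x := x)
  cases s with
  | nil => exact List.nodup_nil
  | cons a l =>
    rw [List.nodup_cons]
    exact ⟨fun h => h2 a rfl (List.mem_map_of_mem h), List.Nodup.of_map _ h1⟩

/-- If `rev x` came after the first dart of `s`, it would start at the vertex where `x` ends, an
inner vertex. As inner vertices are visited once, `rev x` would then be the straight continuation of
`x`, impossible at degree 4. -/
theorem rev_notMem [Finite D] {s : List D} (hs : s ∈ S) {x : D} (hx : x ∈ s) :
    E.rev x ∉ s := by
  have key : ∀ x ∈ s, E.rev x ∉ s.tail := by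
    intro x hx hx'
    rcases getLast_or_exists_rel (hS.1 s hs).2.1 hx with h | ⟨y, hy, hr, hxy⟩
    · exact hS.cell_getLast_notMem hs h (List.mem_map_of_mem hx')
    · have h1 : E.cell y = E.cell (E.rev x) := by rw [hxy, cell_straight hr]
      have h2 : y = E.rev x :=
        List.inj_on_of_nodup_map (hS.1 s hs).2.2 hy hx' h1
      rw [hxy] at h2
      exact E.next_two_ne hr h2
  intro hx'
  have h1 := (head_or_mem_tail hx').resolve_right (key x hx)
  have h2 := (head_or_mem_tail hx).resolve_right (by
    have := key _ hx'
    rwa [E.rev_rev] at this)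
  rw [h1] at h2
  exact E.rev_ne x (Option.some.inj h2)

/-- A regular vertex on a segment lies in the interior of a segment. -/
theorem exists_mem_inner {d : D} (hd : d ∈ E.covered S) (hr : E.IsRegular (E.cell d)) :
    ∃ s ∈ S, E.cell d ∈ E.innerVertices s := by
  obtain ⟨s, hs, h | h⟩ := hd
  · rcases mem_inner_or_head h with h1 | h1
    · rcases (hS.2.2 s hs).1 d h1 with h2 | ⟨t, ht, -, h2⟩
      · exact (h2 hr).elim
      · exact ⟨t, ht, h2⟩
    · exact ⟨s, hs, h1⟩
  · rcases (hS.1 s hs).mem_inner_or_getLast h with h1 | h1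
    · have h3 := (hS.2.2 s hs).2 _ h1
      rw [E.rev_rev] at h3
      rcases h3 with h2 | ⟨t, ht, -, h2⟩
      · exact (h2 hr).elim
      · exact ⟨t, ht, h2⟩
    · rw [E.rev_rev] at h1
      exact ⟨s, hs, h1⟩

theorem onSegment_iff {c : E.Cell} (hc : E.IsRegular c) :
    E.OnSegment S c ↔ ∃ s ∈ S, c ∈ E.innerVertices s := by
  constructor
  · rintro ⟨d, hd, rfl⟩
    exact hS.exists_mem_inner hd hc
  · rintro ⟨s, hs, h⟩
    obtain ⟨d, hd, rfl⟩ := List.mem_map.1 h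
    exact ⟨d, ⟨s, hs, Or.inl (List.mem_of_mem_tail hd)⟩, rfl⟩

theorem ncard_covered [Finite D] : (E.covered S).ncard = 2 * ∑ s ∈ S, s.length := by
  classical
  have hset : E.covered S = ((S.biUnion fun s => s.toFinset ∪ s.toFinset.image E.rev : Finset D) :
      Set D) := by
    ext d
    simp only [covered, Finset.coe_biUnion, Finset.coe_union, Set.mem_iUnion, Set.mem_union,
      Finset.mem_coe, List.mem_toFinset, Finset.mem_image, exists_prop, Set.mem_ofPred_eq]
    refine exists_congr fun s => and_congr_right fun _ => or_congr_right ⟨?_, ?_⟩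
    · exact fun h => ⟨_, h, E.rev_rev d⟩
    · rintro ⟨e, he, rfl⟩
      rwa [E.rev_rev]
  rw [hset, Set.ncard_coe_finset, Finset.card_biUnion, Finset.mul_sum]
  · refine Finset.sum_congr rfl fun s hs => ?_
    rw [Finset.card_union_of_disjoint, Finset.card_image_of_injective _ E.rev.injective,
      List.toFinset_card_of_nodup (hS.nodup hs), two_mul]
    rw [Finset.disjoint_left]
    intro x hx hx'
    rw [Finset.mem_image] at hx'
    obtain ⟨y, hy, rfl⟩ := hx'
    rw [List.mem_toFinset] at hx hy
    exact hS.rev_notMem hs hy hx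
  · intro s hs t ht hst
    have h := (hS.2.1 s hs t ht hst).1
    rw [Function.onFun, Finset.disjoint_left]
    intro x hx hx'
    simp only [Finset.mem_union, List.mem_toFinset, Finset.mem_image] at hx hx'
    rcases hx with hx | ⟨y, hy, rfl⟩
    · rcases hx' with hx' | ⟨z, hz, rfl⟩
      · exact (h x hx).1 hx'
      · exact (h _ hx).2 (by rwa [E.rev_rev])
    · rcases hx' with hx' | ⟨z, hz, hzy⟩
      · exact (h y hy).2 hx'
      · rw [E.rev.injective hzy] at hz
        exact (h y hy).1 hz

/-- A path with `l` edges has `l - 1` inner vertices, and a regular vertex on the segments is inner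
to exactly one of them. -/
theorem ncard_inner_add_card [Finite D] :
    {c | E.IsRegular c ∧ E.OnSegment S c}.ncard + S.card = ∑ s ∈ S, s.length := by
  classical
  have hset : {c | E.IsRegular c ∧ E.OnSegment S c} =
      ((S.biUnion fun s => (E.innerVertices s).toFinset : Finset E.Cell) : Set E.Cell) := by
    ext c
    simp only [Finset.coe_biUnion, Set.mem_iUnion, Finset.mem_coe, List.mem_toFinset,
      exists_prop, Set.mem_ofPred_eq]
    constructor
    · rintro ⟨h1, h2⟩
      exact (hS.onSegment_iff h1).1 h2
    · rintro ⟨s, hs, h⟩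
      have hr := (hS.1 s hs).regular_of_mem_inner h
      exact ⟨hr, (hS.onSegment_iff hr).2 ⟨s, hs, h⟩⟩
  rw [hset, Set.ncard_coe_finset, Finset.card_biUnion, Finset.card_eq_sum_ones,
    ← Finset.sum_add_distrib]
  · refine Finset.sum_congr rfl fun s hs => ?_
    rw [List.toFinset_card_of_nodup (hS.1 s hs).2.2, innerVertices, List.length_map,
      List.length_tail]
    have := List.length_pos_iff.2 (hS.1 s hs).1
    omega
  · intro s hs t ht hst
    rw [Function.onFun, Finset.disjoint_left]
    intro c hc hc'
    rw [List.mem_toFinset] at hc hc'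
    exact (hS.2.1 s hs t ht hst).2 c hc hc'

/-- At most two segment ends per segment. -/
theorem ncard_ends_le [Finite D] :
    {d | d ∈ E.covered S ∧ ¬ E.IsRegular (E.cell d)}.ncard ≤ 2 * S.card := by
  classical
  have hsub : {d | d ∈ E.covered S ∧ ¬ E.IsRegular (E.cell d)} ⊆
      ((S.biUnion fun s => s.head?.toFinset ∪ s.getLast?.toFinset.image E.rev : Finset D) :
        Set D) := by
    rintro d ⟨⟨s, hs, h⟩, hr⟩
    simp only [Finset.coe_biUnion, Finset.coe_union, Set.mem_iUnion, Set.mem_union,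
      Finset.mem_coe, Finset.mem_image, exists_prop]
    refine ⟨s, hs, ?_⟩
    rcases h with h | h
    · rcases mem_inner_or_head (E := E) h with h1 | h1
      · left
        simp [h1]
      · exact (hr ((hS.1 s hs).regular_of_mem_inner h1)).elim
    · rcases (hS.1 s hs).mem_inner_or_getLast h with h1 | h1
      · right
        exact ⟨_, by simp [h1], E.rev_rev d⟩
      · rw [E.rev_rev] at h1
        exact (hr ((hS.1 s hs).regular_of_mem_inner h1)).elim
  have hopt : ∀ o : Option D, o.toFinset.card ≤ 1 := by
    rintro (_ | x) <;> simp
  calc _ ≤ _ := Set.ncard_le_ncard hsub (Set.toFinite _)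
    _ = _ := Set.ncard_coe_finset _
    _ ≤ ∑ s ∈ S, 2 := by
      refine Finset.card_biUnion_le.trans (Finset.sum_le_sum fun s _ => ?_)
      refine (Finset.card_union_le _ _).trans ?_
      have h1 := hopt s.head?
      have h2 := hopt s.getLast?
      have h3 := Finset.card_image_le (s := s.getLast?.toFinset) (f := E.rev)
      omega
    _ = 2 * S.card := by rw [Finset.sum_const, smul_eq_mul, mul_comm]

end IsCutSet

/-! ### Counting corners -/

instance [Finite D] : Finite E.Cell := Finite.of_surjective E.cell fun c => E.exists_cell_eq c

/-- Every rectangle has four corners. -/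
theorem card_mul_four [Finite D] {Y : Set D} {R : Finset E.Rect} (hR : E.IsRectangulation R)
    (h : ∀ r ∈ R, E.IsBlock Y r) :
    4 * R.card = {e | E.AtCrossing e ∧ e ∈ Y ∧ E.rot e ∈ Y}.ncard := by
  classical
  have : Fintype D := Fintype.ofFinite D
  have hset : {e | E.AtCrossing e ∧ e ∈ Y ∧ E.rot e ∈ Y} =
      ((R.biUnion fun r => {e | E.vertex e ∈ r.squares ∧ e ∈ Y ∧ E.rot e ∈ Y}.toFinset :
        Finset D) : Set D) := by
    ext e
    simp only [Finset.coe_biUnion, Set.mem_iUnion, Set.coe_toFinset, exists_prop,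
      Set.mem_ofPred_eq]
    constructor
    · rintro ⟨h1, h2⟩
      obtain ⟨r, ⟨hr, hd⟩, -⟩ := hR.2 e h1
      exact ⟨r, hr, hd, h2⟩
    · rintro ⟨r, hr, hd, h2⟩
      exact ⟨(hR.1 r hr).atCrossing hd, h2⟩
  rw [hset, Set.ncard_coe_finset, Finset.card_biUnion, Finset.sum_congr rfl (fun r hr => ?_),
    Finset.sum_const, smul_eq_mul, mul_comm]
  · rw [← Set.ncard_eq_toFinset_card']
    exact (h r hr).ncard_corners
  · intro r hr r' hr' hne
    rw [Function.onFun, Finset.disjoint_left]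
    intro e he he'
    rw [Set.mem_toFinset] at he he'
    exact hne ((h r hr).eq_of_mem (h r' hr') he.1 he'.1)

theorem ncard_preimage_equiv [Finite D] (f : Equiv.Perm D) (A : Set D) :
    {d | f d ∈ A}.ncard = A.ncard := by
  have : {d | f d ∈ A} = f.symm '' A := by
    ext d
    rw [Equiv.image_symm_eq_preimage]
    rfl
  rw [this, Set.ncard_image_of_injective _ f.symm.injective]

/-- The number of darts that have a side in `Y` and so does the next one, in terms of `Y`. -/
theorem ncard_corners_add [Finite D] {Y : Set D} (hrev : ∀ d, E.rev d ∈ Y ↔ d ∈ Y)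
    (hend : ∀ d, E.AtEnd d → d ∈ Y) :
    {e | E.AtCrossing e ∧ e ∈ Y ∧ E.rot e ∈ Y}.ncard + {d | E.AtEnd d}.ncard + Nat.card D
      = 2 * Y.ncard + {d | d ∉ Y ∧ E.next d ∉ Y}.ncard := by
  -- Inclusion and exclusion for `Y` and its preimage under `next`. The intersection becomes the set
  -- of corners, because `rot (next d) = rev d`; each string endpoint contributes one spurious
  -- corner.
  have h1 := Set.ncard_union_add_ncard_inter Y {d | E.next d ∈ Y}
  rw [ncard_preimage_equiv] at h1
  have h2 := Set.ncard_add_ncard_compl (Y ∪ {d | E.next d ∈ Y})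
  have h3 : (Y ∪ {d | E.next d ∈ Y})ᶜ = {d | d ∉ Y ∧ E.next d ∉ Y} := by
    ext d
    simp
  have hpre : Y ∩ {d | E.next d ∈ Y} = {d | E.next d ∈ {e | e ∈ Y ∧ E.rot e ∈ Y}} := by
    ext d
    have : E.rot (E.next d) = E.rev d := by rw [next_apply, E.rot_four]
    simp only [Set.mem_inter_iff, Set.mem_ofPred_eq, this, hrev, and_comm]
  have h4 : {e | E.AtCrossing e ∧ e ∈ Y ∧ E.rot e ∈ Y} ∪ {d | E.AtEnd d} =
      {e | e ∈ Y ∧ E.rot e ∈ Y} := by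
    ext e
    simp only [Set.mem_union, Set.mem_ofPred_eq]
    constructor
    · rintro (h | h)
      · exact h.2
      · exact ⟨hend e h, hend _ (E.atEnd_rot.2 h)⟩
    · intro h
      by_cases he : E.AtEnd e
      · exact Or.inr he
      · exact Or.inl ⟨he, h⟩
  have h5 := Set.ncard_union_eq (s := {e | E.AtCrossing e ∧ e ∈ Y ∧ E.rot e ∈ Y})
    (t := {d | E.AtEnd d}) (by
      rw [Set.disjoint_left]
      exact fun e he he' => he.1 he') (Set.toFinite _) (Set.toFinite _)
  rw [hpre, ncard_preimage_equiv, ← h4, h5] at h1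
  rw [h3] at h2
  omega

theorem ncard_darts_of_regular [Finite D] {A : Set E.Cell} (hA : ∀ c ∈ A, E.IsRegular c) :
    {d | E.cell d ∈ A}.ncard = 4 * A.ncard := by
  classical
  have : Fintype D := Fintype.ofFinite D
  have : Fintype E.Cell := Fintype.ofFinite _
  rw [Set.ncard_eq_toFinset_card', Set.ncard_eq_toFinset_card' A,
    Finset.card_eq_sum_card_fiberwise (f := E.cell) (t := A.toFinset),
    Finset.sum_congr rfl (fun c hc => ?_), Finset.sum_const, smul_eq_mul, mul_comm]
  · rw [Set.mem_toFinset] at hc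
    rw [← (hA c hc).2, deg]
    change _ = Set.ncard {d | E.cell d = c}
    rw [Set.ncard_eq_toFinset_card']
    congr 1
    ext d
    simp only [Finset.mem_filter, Set.mem_toFinset, Set.mem_ofPred_eq]
    exact ⟨fun h => h.2, fun h => ⟨h ▸ hc, h⟩⟩
  · intro d hd
    simpa using hd

/-- The number of rectangles of a rectangulation is the number of its segments up to a constant. -/
theorem Delimits.card_eq [Finite D] {S : Finset (List D)} {R : Finset E.Rect}
    (h : E.Delimits S R) (hR : E.IsRectangulation R) :
    4 * R.card + {d | E.AtEnd d}.ncard + Nat.card D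
      = 4 * S.card + 4 * {c | E.IsRegular c}.ncard + 2 * {d | E.IsBorder d}.ncard := by
  have hY := h.isFlat hR
  have h1 := ncard_corners_add (E := E) (Y := E.walls S) hY.rev_mem hY.atEnd_mem
  rw [← card_mul_four hR (h.isBlock hR)] at h1
  have h2 : (E.walls S).ncard = (E.covered S).ncard + {d | E.IsBorder d}.ncard :=
    Set.ncard_union_eq (Set.disjoint_left.2 fun d hd => h.not_isBorder hd) (Set.toFinite _)
      (Set.toFinite _)
  have h3 := h.1.ncard_covered
  have h4 := h.1.ncard_inner_add_card
  have hempty : {d | d ∉ E.walls S ∧ E.next d ∉ E.walls S} =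
      {d | E.cell d ∈ {c | E.IsRegular c ∧ ¬ E.OnSegment S c}} := by
    ext d
    constructor
    · rintro ⟨h0, h1⟩
      obtain ⟨hr, hc⟩ := hY.regular (fun _ h => Or.inr h) h0 h1
      exact ⟨hr, fun ⟨e, he, hec⟩ => hc e hec (Or.inl he)⟩
    · rintro ⟨hr, hc⟩
      have key : ∀ e, E.cell e = E.cell d → e ∉ E.walls S := by
        rintro e he (h1 | h1)
        · exact hc ⟨e, h1, he⟩
        · exact hr.1 e he h1
      exact ⟨key d rfl, key _ (E.cell_next_of_regular hr)⟩
  have h5 : {d | d ∉ E.walls S ∧ E.next d ∉ E.walls S}.ncard =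
      4 * {c | E.IsRegular c ∧ ¬ E.OnSegment S c}.ncard := by
    rw [hempty]
    exact ncard_darts_of_regular fun c hc => hc.1
  have h6 : {c | E.IsRegular c}.ncard = {c | E.IsRegular c ∧ E.OnSegment S c}.ncard +
      {c | E.IsRegular c ∧ ¬ E.OnSegment S c}.ncard := by
    rw [← Set.ncard_union_eq _ (Set.toFinite _) (Set.toFinite _)]
    · congr 1
      ext c
      simp only [Set.mem_union, Set.mem_ofPred_eq]
      tauto
    · rw [Set.disjoint_left]
      exact fun c hc hc' => hc'.2 hc.2
  -- The length sum cancels: a regular vertex on the segments contributes 4 through `h3` and `h4`,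
  -- one off the segments contributes 4 through `h5`, so only the number of all regular vertices
  -- remains.
  omega

/-! ### Euler's formula -/

instance [Finite D] : Finite E.Face := Quotient.finite _

instance [Finite D] : Finite E.Vertex := Quotient.finite _

/-- A face without string endpoints is a single cell, regular or a vertex-hole; any other face
carries a boundary-hole. In each case the face can be recovered from this object. -/
theorem card_face_le [Finite D] :
    Nat.card E.Face ≤ {c | E.IsRegular c}.ncard + Nat.card E.Hole := by
  have hsurj : ∀ f : E.Face, ∃ x : {c // E.IsRegular c} ⊕ E.Hole, ∃ d, E.face d = f ∧
      Sum.elim (fun c => E.cell d = c.1) (E.StartsOn d) x := by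
    intro f
    obtain ⟨d, rfl⟩ := Quotient.exists_rep f
    change ∃ x : {c // E.IsRegular c} ⊕ E.Hole, ∃ e, E.face e = E.face d ∧ _
    by_cases h1 : E.HasBoundaryHole (E.face d)
    · exact ⟨Sum.inr (Sum.inr ⟨_, h1⟩), d, rfl, rfl⟩
    by_cases h2 : E.IsRegular (E.cell d)
    · exact ⟨Sum.inl ⟨_, h2⟩, d, rfl, rfl⟩
    have h3 : E.IsInterior (E.cell d) := by
      rintro e he (h | h)
      · exact h1 ⟨e, E.face_eq_of_cell_eq he, h⟩
      · exact h1 ⟨E.next e, (E.face_next e).trans (E.face_eq_of_cell_eq he), E.atEnd_next.2 h⟩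
    exact ⟨Sum.inr (Sum.inl ⟨_, h3, fun h => h2 ⟨h3, h⟩⟩), d, rfl, rfl⟩
  choose g hg using hsurj
  have hinj : Function.Injective g := by
    intro f f' h
    obtain ⟨d, rfl, hd⟩ := hg f
    obtain ⟨d', rfl, hd'⟩ := hg f'
    rw [← h] at hd'
    generalize g (E.face d) = x at hd hd'
    rcases x with c | c | c
    · exact E.face_eq_of_cell_eq (hd.trans hd'.symm)
    · exact E.face_eq_of_cell_eq (hd.trans hd'.symm)
    · exact hd.trans hd'.symm
  have := Nat.card_le_card_of_injective g hinj
  rw [Nat.card_sum] at this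
  exact this

theorem ncard_fiber_sum {V : Type*} [Finite D] [Fintype V] (f : D → V) (A : Set D) :
    A.ncard = ∑ v, {d | d ∈ A ∧ f d = v}.ncard := by
  classical
  have : Fintype D := Fintype.ofFinite D
  rw [Set.ncard_eq_toFinset_card',
    Finset.card_eq_sum_card_fiberwise (f := f) (t := Finset.univ) (by simp)]
  refine Finset.sum_congr rfl fun v _ => ?_
  rw [Set.ncard_eq_toFinset_card']
  congr 1
  ext d
  simp

theorem card_le_two_mul_edges [Finite D] :
    Nat.card D ≤ 2 * Nat.card (Quotient (Equiv.Perm.SameCycle.setoid E.rev)) := by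
  classical
  have : Fintype (Quotient (Equiv.Perm.SameCycle.setoid E.rev)) := Fintype.ofFinite _
  rw [← Set.ncard_univ,
    ncard_fiber_sum (fun d => (Quotient.mk (Equiv.Perm.SameCycle.setoid E.rev) d)) Set.univ,
    Nat.card_eq_fintype_card, mul_comm, ← smul_eq_mul, ← Finset.card_univ, ← Finset.sum_const]
  refine Finset.sum_le_sum fun v _ => ?_
  obtain ⟨d, rfl⟩ := Quotient.exists_rep v
  have hsub : {e | e ∈ Set.univ ∧ Quotient.mk (Equiv.Perm.SameCycle.setoid E.rev) e = ⟦d⟧} ⊆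
      {d, E.rev d} := by
    rintro e ⟨-, he⟩
    have h' : E.rev.SameCycle d e := (Quotient.exact he : E.rev.SameCycle e d).symm
    obtain ⟨k, -, rfl⟩ := h'.exists_pow_eq'
    have h2 : E.rev ^ 2 = 1 := by
      ext d
      simpa [pow_succ] using E.rev_rev d
    rw [pow_eq_pow_mod k h2]
    have := Nat.mod_lt k (show 2 > 0 by norm_num)
    interval_cases k % 2 <;> simp
  refine (Set.ncard_le_ncard hsub (Set.toFinite _)).trans ((Set.ncard_insert_le _ _).trans ?_)
  rw [Set.ncard_singleton]

/-- A crossing has four darts, and the summand 3 makes up for the three darts missing at an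
endpoint. -/
theorem four_mul_vertices_le [Finite D] :
    4 * Nat.card E.Vertex ≤ Nat.card D + 3 * {d | E.AtEnd d}.ncard := by
  classical
  have : Fintype E.Vertex := Fintype.ofFinite _
  rw [← Set.ncard_univ D, ncard_fiber_sum E.vertex Set.univ, ncard_fiber_sum E.vertex {d | E.AtEnd d},
    Nat.card_eq_fintype_card, mul_comm, ← smul_eq_mul, ← Finset.card_univ, ← Finset.sum_const,
    Finset.mul_sum, ← Finset.sum_add_distrib]
  refine Finset.sum_le_sum fun v _ => ?_
  obtain ⟨d, rfl⟩ := Quotient.exists_rep v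
  change 4 ≤ {e | e ∈ Set.univ ∧ E.vertex e = E.vertex d}.ncard +
    3 * {e | e ∈ {d | E.AtEnd d} ∧ E.vertex e = E.vertex d}.ncard
  by_cases hd : E.AtEnd d
  · have h1 : 0 < {e | e ∈ Set.univ ∧ E.vertex e = E.vertex d}.ncard :=
      (Set.ncard_pos (Set.toFinite _)).2 ⟨d, trivial, rfl⟩
    have h2 : 0 < {e | e ∈ {d | E.AtEnd d} ∧ E.vertex e = E.vertex d}.ncard :=
      (Set.ncard_pos (Set.toFinite _)).2 ⟨d, hd, rfl⟩
    omega
  · have hsub : (fun k => (E.rot ^ k) d) '' Set.Iio 4 ⊆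
        {e | e ∈ Set.univ ∧ E.vertex e = E.vertex d} := by
      rintro _ ⟨k, hk, rfl⟩
      have hk : k < 4 := hk
      refine ⟨trivial, ?_⟩
      dsimp only
      interval_cases k <;> simp [pow_succ, vertex_rot]
    have h1 := Set.ncard_le_ncard hsub (Set.toFinite _)
    rw [Set.InjOn.ncard_image, Set.ncard_eq_toFinset_card'] at h1
    · simp only [Set.toFinset_Iio, Nat.card_Iio] at h1
      omega
    · intro k hk k' hk' h
      have e1 : E.rot d ≠ d := hd
      have e2 := E.rot_rot_ne hd
      have e3 := E.rot_rot_rot_ne hd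
      have hk : k < 4 := hk
      have hk' : k' < 4 := hk'
      interval_cases k <;> interval_cases k' <;> simp [pow_succ, eq_comm] at h ⊢ <;>
        first | exact e1 h | exact e1 h.symm | exact e2 h | exact e2 h.symm | exact e3 h |
          exact e3 h.symm

theorem euler_bound [Finite D] :
    Nat.card D + 8 ≤ 4 * {c | E.IsRegular c}.ncard + 4 * Nat.card E.Hole +
      3 * {d | E.AtEnd d}.ncard := by
  have h1 : Nat.card E.Vertex + Nat.card E.Face =
    Nat.card (Quotient (Equiv.Perm.SameCycle.setoid E.rev)) + 2 := E.euler
  have h2 := E.card_face_le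
  have h3 := E.card_le_two_mul_edges
  have h4 := E.four_mul_vertices_le
  omega

/-- Only a single string without crossings has a piece with two endpoints of strings. -/
theorem not_atEnd_rev {x : D} (hx : ¬ E.IsBorder x) {d : D} (hd : E.AtEnd d) :
    ¬ E.AtEnd (E.rev d) := by
  intro hd'
  obtain ⟨g, hg, hgd⟩ := E.connected d x
  -- If both ends of `d` were endpoints, `{d, rev d}` would be invariant under both generators,
  -- hence all of `D` by connectedness, and `x` would be a border dart.
  have key : ∀ g ∈ Subgroup.closure {E.rot, E.rev}, ∀ e, (e = d ∨ e = E.rev d) →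
      (g e = d ∨ g e = E.rev d) := by
    have h1 : E.rot d = d := hd
    have h2 : E.rot (E.rev d) = E.rev d := hd'
    have h1' : E.rot⁻¹ d = d := by rw [Equiv.Perm.inv_eq_iff_eq, h1]
    have h2' : E.rot⁻¹ (E.rev d) = E.rev d := by rw [Equiv.Perm.inv_eq_iff_eq, h2]
    have h3 : E.rev⁻¹ d = E.rev d := by rw [Equiv.Perm.inv_eq_iff_eq, E.rev_rev]
    intro g hg
    induction hg using Subgroup.closure_induction'' with
    | mem g hg =>
      rcases hg with rfl | rfl
      · rintro e (rfl | rfl)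
        exacts [Or.inl h1, Or.inr h2]
      · rintro e (rfl | rfl)
        exacts [Or.inr rfl, Or.inl (E.rev_rev _)]
    | inv_mem g hg =>
      rcases hg with rfl | rfl
      · rintro e (rfl | rfl)
        exacts [Or.inl h1', Or.inr h2']
      · rintro e (rfl | rfl)
        exacts [Or.inr h3, Or.inl (by rw [Equiv.Perm.inv_eq_iff_eq])]
    | one => exact fun e h => h
    | mul g g' _ _ ih ih' => exact fun e h => ih _ (ih' e h)
  rcases key g hg d (Or.inl rfl) with h | h
  · rw [hgd] at h
    exact hx (Or.inl (h ▸ hd))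
  · rw [hgd] at h
    exact hx (Or.inl (h ▸ hd'))

theorem ncard_border [Finite D] {x : D} (hx : ¬ E.IsBorder x) :
    {d | E.IsBorder d}.ncard = 2 * {d | E.AtEnd d}.ncard := by
  have h : {d | E.IsBorder d} = {d | E.AtEnd d} ∪ {d | E.rev d ∈ {d | E.AtEnd d}} := rfl
  rw [h, Set.ncard_union_eq _ (Set.toFinite _) (Set.toFinite _), ncard_preimage_equiv, two_mul]
  rw [Set.disjoint_left]
  exact fun d hd => E.not_atEnd_rev hx hd

/-! ### Counting segment ends -/

/-- Each of the two ends of a segment lies on at most one hole. -/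
theorem sum_incidence_le [Finite D] [Fintype E.Hole] (S : Finset (List D)) :
    ∑ h : E.Hole, E.incidence S h ≤ 2 * S.card := by
  classical
  have key : ∀ (p : E.Hole → Prop) [DecidablePred p], (∀ h h', p h → p h' → h = h') →
      ∑ h : E.Hole, (if p h then 1 else 0) ≤ 1 := by
    intro p _ hp
    rw [Finset.sum_boole, Nat.cast_id, Finset.card_le_one]
    intro h hh h' hh'
    exact hp _ _ (Finset.mem_filter.1 hh).2 (Finset.mem_filter.1 hh').2
  unfold incidence
  rw [Finset.sum_comm]
  calc _ ≤ ∑ s ∈ S, 2 := by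
        refine Finset.sum_le_sum fun s _ => ?_
        rw [Finset.sum_add_distrib]
        refine Nat.add_le_add (key _ ?_) (key _ ?_)
        · rintro h h' ⟨d, hd, h1⟩ ⟨d', hd', h2⟩
          obtain rfl : d = d' := Option.mem_unique hd hd'
          exact E.hole_unique h1 h2
        · rintro h h' ⟨d, hd, h1⟩ ⟨d', hd', h2⟩
          obtain rfl : d = d' := Option.mem_unique hd hd'
          exact E.hole_unique h1 h2
    _ = 2 * S.card := by rw [Finset.sum_const, smul_eq_mul, mul_comm]

theorem three_mul_holes_le [Finite D] {S : Finset (List D)} (h : 3 ≤ E.deltaRect S) :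
    3 * Nat.card E.Hole ≤ 2 * S.card := by
  have : Fintype E.Hole := Fintype.ofFinite _
  refine le_trans ?_ (sum_incidence_le (E := E) S)
  rw [Nat.card_eq_fintype_card, ← Finset.card_univ, mul_comm, ← smul_eq_mul, ← Finset.sum_const]
  refine Finset.sum_le_sum fun x _ => h.trans ?_
  exact ciInf_le (OrderBot.bddBelow _) x

/-- The segment edges at a vertex saturate it, so they bound its exponent. No segment passes through
a non-regular vertex, so the edges counted are segment ends, two per segment. -/
theorem sum_exponent_le [Finite D] {S : Finset (List D)} {R : Finset E.Rect}
    (h : E.Delimits S R) (hR : E.IsRectangulation R) {order : List E.Cell} (hnodup : order.Nodup)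
    (horder : ∀ c ∈ order, ¬ E.IsRegular c) :
    (order.map E.exponent).sum ≤ 2 * S.card := by
  classical
  have : Fintype D := Fintype.ofFinite D
  refine le_trans ?_ h.1.ncard_ends_le
  rw [← List.sum_toFinset _ hnodup]
  let X : E.Cell → Finset D := fun c => {d | d ∈ E.covered S ∧ E.cell d = c}
  have hX : ∀ c ∈ order, E.exponent c ≤ (X c).card := by
    intro c hc
    apply exponent_le
    refine ((h.isFlat hR).saturates c).mono (horder c hc) fun d hd hb hdX => ?_
    rw [thick_covered] at hdX
    exact Or.inl (by simpa [X, hd] using hdX.resolve_right hb)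
  refine (Finset.sum_le_sum fun c hc => hX c (List.mem_toFinset.1 hc)).trans ?_
  rw [← Finset.card_biUnion, ← Set.ncard_coe_finset]
  · refine Set.ncard_le_ncard ?_ (Set.toFinite _)
    intro d hd
    rw [Finset.mem_coe, Finset.mem_biUnion] at hd
    obtain ⟨c, hc, hd⟩ := hd
    obtain ⟨h1, rfl⟩ := (Finset.mem_filter.1 hd).2
    exact ⟨h1, horder _ (List.mem_toFinset.1 hc)⟩
  · intro c _ c' _ hne
    rw [Function.onFun, Finset.disjoint_left]
    intro d hd hd'
    exact hne ((Finset.mem_filter.1 hd).2.2.symm.trans (Finset.mem_filter.1 hd').2.2)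

/-- The comparison of an optimal rectangulation with one that has few segments. -/
theorem Delimits.card_le [Finite D] {S S' : Finset (List D)} {R R' : Finset E.Rect}
    (h : E.Delimits S R) (hR : E.IsRectangulation R) (hδ : 3 ≤ E.deltaRect S)
    (h' : E.Delimits S' R') (hR' : E.IsRectangulation R') (hS : S'.card ≤ 2 * S.card) :
    R'.card + 2 ≤ 4 * R.card := by
  have h1 := h.card_eq hR
  have h2 := h'.card_eq hR'
  have h3 := three_mul_holes_le hδ
  have h4 := euler_bound (E := E)
  -- An infimum over an empty type of holes would be 0. A hole yields a segment, and a segment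
  -- yields the non-border edge that `ncard_border` asks for.
  have h5 : Nonempty E.Hole := by
    by_contra hempty
    rw [not_nonempty_iff] at hempty
    have : E.deltaRect S = 0 := by
      unfold deltaRect
      exact Nat.iInf_of_empty _
    omega
  have h6 : 0 < Nat.card E.Hole := Nat.card_pos
  obtain ⟨s, hs⟩ : S.Nonempty := by
    rw [← Finset.card_pos]
    omega
  obtain ⟨x, hx⟩ := List.exists_mem_of_ne_nil s (h.1.1 s hs).1
  have h7 := ncard_border (h.not_isBorder ⟨s, hs, Or.inl hx⟩)
  -- With `H` holes, `h1`, `h4` and `h7` give `S.card ≤ R.card + H - 2`, and `h3` turns this into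
  -- `S.card ≤ 3 * R.card - 6`; the rest is `R'.card - R.card = S'.card - S.card ≤ S.card`.
  omega

/-! ### Straight walks from a hole -/

theorem straight_injective : Function.Injective E.straight :=
  (E.next * E.next * E.rev).injective

theorem rev_straight [Finite D] {d : D} (h : E.IsRegular (E.cell (E.rev d))) :
    E.straight (E.rev (E.straight d)) = E.rev d := by
  unfold straight
  rw [E.rev_rev, E.next_four h]

/-- A straight walk in the net runs between two strings. The tails of its darts lie on one of them;
the heads lie on the other, which the lemma on the reversed darts treats. -/
theorem sameCycle_left (d : D) : E.fwd.SameCycle (E.rot (E.rot (E.rot d)))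
    (E.rot (E.rot (E.rot (E.straight d)))) := by
  have h : E.fwd (E.rot (E.rot (E.rot d))) = E.rot (E.rot (E.rot (E.straight d))) := by
    rw [straight, next_apply, next_apply, E.rev_rev, E.rot_four, fwd_apply]
  exact h ▸ E.sameCycle_fwd _

theorem sameCycle_right [Finite D] {d : D} (h : E.IsRegular (E.cell (E.rev d))) :
    E.fwd.SameCycle (E.rot (E.rot (E.rot (E.rev d))))
      (E.rot (E.rot (E.rot (E.rev (E.straight d))))) := by
  have h1 := E.sameCycle_left (E.rev (E.straight d))
  rw [rev_straight h] at h1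
  exact h1.symm

section Walk

variable {d : D} {K : ℕ}
  (hreg : ∀ k < K, E.IsRegular (E.cell (E.rev ((E.straight)^[k] d))))
include hreg

theorem cell_walk_succ {k : ℕ} (hk : k < K) :
    E.cell ((E.straight)^[k + 1] d) = E.cell (E.rev ((E.straight)^[k] d)) := by
  rw [Function.iterate_succ_apply', cell_straight (hreg k hk)]

omit hreg in
theorem sameCycle_walk_left (i j : ℕ) :
    E.fwd.SameCycle (E.rot (E.rot (E.rot ((E.straight)^[i] d))))
      (E.rot (E.rot (E.rot ((E.straight)^[j] d)))) := by
  have key : ∀ i, E.fwd.SameCycle (E.rot (E.rot (E.rot d)))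
      (E.rot (E.rot (E.rot ((E.straight)^[i] d)))) := by
    intro i
    induction i with
    | zero => exact Equiv.Perm.SameCycle.refl _ _
    | succ i ih =>
      rw [Function.iterate_succ_apply']
      exact ih.trans (E.sameCycle_left _)
  exact (key i).symm.trans (key j)

theorem sameCycle_walk_right [Finite D] {i j : ℕ} (hi : i ≤ K) (hj : j ≤ K) :
    E.fwd.SameCycle (E.rot (E.rot (E.rot (E.rev ((E.straight)^[i] d)))))
      (E.rot (E.rot (E.rot (E.rev ((E.straight)^[j] d))))) := by
  have key : ∀ i ≤ K, E.fwd.SameCycle (E.rot (E.rot (E.rot (E.rev d))))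
      (E.rot (E.rot (E.rot (E.rev ((E.straight)^[i] d))))) := by
    intro i
    induction i with
    | zero => exact fun _ => Equiv.Perm.SameCycle.refl _ _
    | succ i ih =>
      intro hi
      rw [Function.iterate_succ_apply']
      exact (ih (by omega)).trans (sameCycle_right (hreg i hi))
  exact (key i hi).symm.trans (key j hj)

/-- If the walk came back along one of its edges, stepping inwards from both ends would produce an
edge equal to its own reverse, or a turn back at a regular vertex. -/
theorem walk_ne_rev [Finite D] (l : ℕ) : ∀ {i j : ℕ}, j + 1 - i ≤ l → i ≤ j + 1 → j < K → i < K →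
    (E.straight)^[j + 1] d ≠ E.rev ((E.straight)^[i] d) := by
  induction l with
  | zero =>
    intro i j h1 h2 h3 h4 h
    obtain rfl : i = j + 1 := by omega
    exact E.rev_ne _ h.symm
  | succ l ih =>
    intro i j h1 h2 h3 h4 h
    rcases Nat.eq_or_lt_of_le h2 with rfl | h5
    · exact E.rev_ne _ h.symm
    rcases Nat.eq_or_lt_of_le (show i ≤ j by omega) with rfl | h6
    · rw [Function.iterate_succ_apply'] at h
      exact E.next_two_ne (hreg i h4) h
    obtain ⟨m, rfl⟩ : ∃ m, j = m + 1 := ⟨j - 1, by omega⟩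
    refine ih (i := i + 1) (j := m) (by omega) (by omega) (by omega) (by omega) ?_
    apply straight_injective (E := E)
    rw [← Function.iterate_succ_apply' (f := E.straight), h,
      Function.iterate_succ_apply' (f := E.straight) (n := i), rev_straight (hreg i h4)]

/-- Since no string crosses itself, a straight walk that starts at a hole does not cross itself. -/
theorem walk_cell_ne [Finite D] (hd : ¬ E.IsRegular (E.cell d)) {i j : ℕ} (hij : i < j) (hj : j < K) :
    E.cell ((E.straight)^[i + 1] d) ≠ E.cell ((E.straight)^[j + 1] d) := by
  intro h
  have hi := hreg i (hij.trans hj)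
  have hcell := cell_walk_succ hreg (hij.trans hj)
  have hr : E.IsRegular (E.cell ((E.straight)^[j + 1] d)) := by rwa [← h, hcell]
  have hnb := E.not_isBorder_of_regular hr
  -- The walk could come back to a vertex in four directions. Reversed: excluded by `walk_ne_rev`.
  -- At a right angle, from either side: the string that accompanies the walk on one of its sides
  -- would cross itself. In the same direction: the walk would be periodic, and its start regular.
  rcases E.eq_of_cell_eq_regular hi (h.symm.trans hcell) with h1 | h1 | h1 | h1
  · exact walk_ne_rev hreg _ le_rfl (by omega) hj (by omega) h1
  · have h2 := sameCycle_walk_left (E := E) (d := d) (j + 1) i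
    rw [next_apply, E.rev_rev] at h1
    rw [← h1] at h2
    refine E.not_sameCycle_rot (d := E.rot (E.rot (E.rot ((E.straight)^[j + 1] d)))) ?_ ?_
    · simp only [atCrossing_rot]
      exact fun h => hnb (Or.inl h)
    · rwa [E.rot_four]
  · obtain ⟨m, rfl⟩ : ∃ m, j = i + m + 1 := ⟨j - i - 1, by omega⟩
    have h2 : (E.straight)^[i + 1] ((E.straight)^[m + 1] d) = (E.straight)^[i + 1] d := by
      rw [← Function.iterate_add_apply, show i + 1 + (m + 1) = i + m + 1 + 1 by omega, h1,
        Function.iterate_succ_apply']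
      rfl
    have h3 := straight_injective.iterate _ h2
    apply hd
    rw [← h3, cell_walk_succ hreg (by omega)]
    exact hreg m (by omega)
  · have h2 := sameCycle_walk_right hreg (i := j + 1) (j := i + 1) (by omega) (by omega)
    have h3 : (E.straight)^[j + 1] d = E.rot (E.rot (E.rot (E.rev ((E.straight)^[i + 1] d)))) := by
      rw [h1, Function.iterate_succ_apply' (f := E.straight) (n := i), ← next_apply]
      rfl
    rw [← h3, ← fwd_apply] at h2
    refine E.not_sameCycle_rot (d := E.fwd ((E.straight)^[j + 1] d)) ?_
      ((E.sameCycle_fwd _).symm.trans h2.symm)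
    simp only [fwd_apply, atCrossing_rot]
    exact fun h => hnb (Or.inr h)

end Walk

/-- `straight` is a permutation of a finite set, so an endless walk through regular vertices would
return to its start, which is not regular. -/
theorem exists_walk_end [Finite D] {d : D} (hd : ¬ E.IsRegular (E.cell d)) :
    ∃ k, ¬ E.IsRegular (E.cell (E.rev ((E.straight)^[k] d))) := by
  by_contra h
  push Not at h
  obtain ⟨p, hp, hpd⟩ := Function.Injective.mem_periodicPts E.straight_injective d
  obtain ⟨m, rfl⟩ : ∃ m, p = m + 1 := ⟨p - 1, by omega⟩
  apply hd
  have h1 := cell_walk_succ (E := E) (d := d) (K := m + 1) (fun k _ => h k) (k := m) (by omega)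
  rw [show (E.straight)^[m + 1] d = d from hpd] at h1
  rw [h1]
  exact h m

theorem exists_shot [Finite D] {S : Finset (List D)} {d : D} (hd : ¬ E.IsRegular (E.cell d))
    (hb : ¬ E.IsBorder d) (hS : d ∉ E.covered S) : ∃ s, E.IsShot S d s := by
  classical
  have hex : ∃ k, ¬ E.IsRegular (E.cell (E.rev ((E.straight)^[k] d))) ∨
      E.OnSegment S (E.cell (E.rev ((E.straight)^[k] d))) := by
    obtain ⟨k, hk⟩ := exists_walk_end hd
    exact ⟨k, Or.inl hk⟩
  obtain ⟨K, hK, hmin⟩ : ∃ K, (¬ E.IsRegular (E.cell (E.rev ((E.straight)^[K] d))) ∨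
      E.OnSegment S (E.cell (E.rev ((E.straight)^[K] d)))) ∧
      ∀ k < K, E.IsRegular (E.cell (E.rev ((E.straight)^[k] d))) ∧
        ¬ E.OnSegment S (E.cell (E.rev ((E.straight)^[k] d))) := by
    refine ⟨Nat.find hex, Nat.find_spec hex, fun k hk => ?_⟩
    have := Nat.find_min hex hk
    rwa [not_or, not_not] at this
  have hreg := fun k hk => (hmin k hk).1
  have hinner : E.innerVertices ((List.range (K + 1)).map fun k => (E.straight)^[k] d) =
      (List.range K).map fun k => E.cell ((E.straight)^[k + 1] d) := by
    rw [innerVertices, List.range_succ_eq_map]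
    simp only [List.map_cons, List.tail_cons, List.map_map]
    rfl
  have hlast : ((List.range (K + 1)).map fun k => (E.straight)^[k] d).getLast? =
      some ((E.straight)^[K] d) := by
    rw [List.range_succ]
    simp
  refine ⟨(List.range (K + 1)).map fun k => (E.straight)^[k] d, hb, hS, ⟨?_, ?_, ?_⟩, ?_, ?_, ?_⟩
  · simp
  · rw [List.isChain_map, List.isChain_iff_getElem]
    intro i hi
    simp only [List.length_range] at hi
    simp only [List.getElem_range]
    exact ⟨hreg i (by omega), Function.iterate_succ_apply' _ _ _⟩
  · rw [hinner]
    refine List.Nodup.map_on ?_ List.nodup_range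
    intro i hi j hj h
    rw [List.mem_range] at hi hj
    by_contra hne
    rcases lt_or_gt_of_ne hne with h1 | h1
    · exact walk_cell_ne hreg hd h1 hj h
    · exact walk_cell_ne hreg hd h1 hi h.symm
  · rw [List.range_succ_eq_map]
    rfl
  · rw [hinner]
    intro c hc
    obtain ⟨k, hk, rfl⟩ := List.mem_map.1 hc
    rw [List.mem_range] at hk
    rw [cell_walk_succ hreg hk]
    exact (hmin k hk).2
  · rw [hlast]
    rintro e he
    obtain rfl : (E.straight)^[K] d = e := Option.some.inj he
    exact hK

/-! ### The greedy strategy -/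

/-- Cut-sets without border edges. -/
structure IsProperCutSet (E : StringSystem D) (S : Finset (List D)) : Prop where
  cutSet : E.IsCutSet S
  not_isBorder : ∀ d ∈ E.covered S, ¬ E.IsBorder d

theorem isProperCutSet_empty : E.IsProperCutSet ∅ :=
  ⟨⟨by simp, by simp, by simp⟩, by simp [covered]⟩

theorem covered_mono {S T : Finset (List D)} (h : S ⊆ T) : E.covered S ⊆ E.covered T :=
  fun _ ⟨s, hs, hd⟩ => ⟨s, h hs, hd⟩

open Classical in
-- The interior of the shot avoids the earlier segments, and its far end is on a hole or, by
-- `IsCutSet.onSegment_iff`, inside one of them. The near end is valid only because shots start at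
-- non-regular vertices.
theorem IsShot.insert [Finite D] {S : Finset (List D)} {d : D} {s : List D}
    (hs : E.IsShot S d s) (hS : E.IsProperCutSet S) (hd : ¬ E.IsRegular (E.cell d)) :
    E.IsProperCutSet (insert s S) ∧ s ∉ S ∧ d ∈ E.covered (insert s S) := by
  obtain ⟨hb, hdS, hpath, hhead, hin, hlast⟩ := hs
  have hds : d ∈ s := List.mem_of_mem_head? hhead
  have hsS : s ∉ S := fun h => hdS ⟨s, h, Or.inl hds⟩
  have hnew : ∀ x ∈ s, x ∉ E.covered S := by
    intro x hx hxS
    rcases mem_inner_or_head (E := E) hx with h | h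
    · rw [hhead] at h
      exact hdS (Option.some.inj h ▸ hxS)
    · exact hin _ h ⟨x, hxS, rfl⟩
  have hold : ∀ t ∈ S, ∀ c ∈ E.innerVertices t, E.OnSegment S c := fun t ht c hc =>
    (hS.cutSet.onSegment_iff ((hS.cutSet.1 t ht).regular_of_mem_inner hc)).2 ⟨t, ht, hc⟩
  have hdisj : ∀ t ∈ S, ((∀ d ∈ s, d ∉ t ∧ E.rev d ∉ t) ∧
      ∀ c ∈ E.innerVertices s, c ∉ E.innerVertices t) := by
    intro t ht
    refine ⟨fun x hx => ⟨fun h => hnew x hx ⟨t, ht, Or.inl h⟩,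
      fun h => hnew x hx ⟨t, ht, Or.inr h⟩⟩, fun c hc hct => hin c hc (hold t ht c hct)⟩
  have hvalid : ∀ {t c}, E.IsValidEnd S t c → E.IsValidEnd (Insert.insert s S) t c := by
    rintro t c (h | ⟨u, hu, hut, hc⟩)
    · exact Or.inl h
    · exact Or.inr ⟨u, Finset.mem_insert_of_mem hu, hut, hc⟩
  refine ⟨⟨⟨?_, ?_, ?_⟩, ?_⟩, hsS, s, Finset.mem_insert_self _ _, Or.inl hds⟩
  · intro t ht
    rcases Finset.mem_insert.1 ht with rfl | ht
    exacts [hpath, hS.cutSet.1 t ht]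
  · intro t ht u hu htu
    rcases Finset.mem_insert.1 ht with rfl | ht' <;>
      rcases Finset.mem_insert.1 hu with rfl | hu'
    · exact (htu rfl).elim
    · exact hdisj u hu'
    · obtain ⟨h1, h2⟩ := hdisj t ht'
      refine ⟨fun x hx => ⟨fun h => (h1 x h).1 hx, fun h => (h1 _ h).2 (by rwa [E.rev_rev])⟩,
        fun c hc hcu => h2 c hcu hc⟩
    · exact hS.cutSet.2.1 t ht' u hu' htu
  · intro t ht
    rcases Finset.mem_insert.1 ht with rfl | ht
    · refine ⟨fun x hx => ?_, fun x hx => ?_⟩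
      · rw [hhead] at hx
        obtain rfl : d = x := Option.some.inj hx
        exact Or.inl hd
      · by_cases hr : E.IsRegular (E.cell (E.rev x))
        · have h1 := (hlast x hx).resolve_left (not_not.2 hr)
          obtain ⟨u, hu, hc⟩ := (hS.cutSet.onSegment_iff hr).1 h1
          exact Or.inr ⟨u, Finset.mem_insert_of_mem hu, fun h => hsS (h ▸ hu), hc⟩
        · exact Or.inl hr
    · obtain ⟨h1, h2⟩ := hS.cutSet.2.2 t ht
      exact ⟨fun x hx => hvalid (h1 x hx), fun x hx => hvalid (h2 x hx)⟩
  · have hsb : ∀ x ∈ s, ¬ E.IsBorder x := by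
      intro x hx
      rcases mem_inner_or_head (E := E) hx with h | h
      · rw [hhead] at h
        exact Option.some.inj h ▸ hb
      · exact E.not_isBorder_of_regular (hpath.regular_of_mem_inner h)
    rintro x ⟨t, ht, hx⟩
    rcases Finset.mem_insert.1 ht with rfl | ht
    · rcases hx with hx | hx
      · exact hsb x hx
      · exact fun h => hsb _ hx (E.isBorder_rev.2 h)
    · exact hS.not_isBorder x ⟨t, ht, hx⟩

theorem Shots.spec [Finite D] {c : E.Cell} {S T : Finset (List D)} {k : ℕ}
    (h : E.Shots c S k T) (hc : ¬ E.IsRegular c) (hS : E.IsProperCutSet S) :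
    E.IsProperCutSet T ∧ T.card = S.card + k ∧ S ⊆ T := by
  classical
  induction h with
  | nil S => exact ⟨hS, rfl, subset_rfl⟩
  | cons S T k d s hd hs _ ih =>
    subst hd
    obtain ⟨h1, h2, -⟩ := hs.insert hS hc
    obtain ⟨h3, h4, h5⟩ := ih h1
    refine ⟨h3, ?_, (Finset.subset_insert _ _).trans h5⟩
    rw [h4, Finset.card_insert_of_notMem h2]
    omega

/-- Shoot along the edges of `X` at `c` one by one, skipping those covered in the meantime, for
instance by a shot that returned to `c`. A dart of `X` that points towards `c` is replaced by its
reverse. -/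
theorem exists_shots [Finite D] {c : E.Cell} (hc : ¬ E.IsRegular c) (X : Finset D) :
    ∀ {S : Finset (List D)}, E.IsProperCutSet S → ∃ k T, k ≤ X.card ∧ E.Shots c S k T ∧
      ∀ x ∈ X, ¬ E.IsBorder x → (E.cell x = c ∨ E.cell (E.rev x) = c) → x ∈ E.covered T := by
  classical
  induction X using Finset.induction_on with
  | empty => exact fun {S} _ => ⟨0, S, le_rfl, Shots.nil S, by simp⟩
  | insert x X hx ih =>
    intro S hS
    have hcard : (insert x X).card = X.card + 1 := Finset.card_insert_of_notMem hx
    by_cases hneed : ¬ E.IsBorder x ∧ (E.cell x = c ∨ E.cell (E.rev x) = c) ∧ x ∉ E.covered S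
    · obtain ⟨hb, hxc, hxS⟩ := hneed
      obtain ⟨e, he, hec⟩ : ∃ e, (e = x ∨ e = E.rev x) ∧ E.cell e = c := by
        rcases hxc with h | h
        exacts [⟨_, Or.inl rfl, h⟩, ⟨_, Or.inr rfl, h⟩]
      have heb : ¬ E.IsBorder e := by
        rcases he with rfl | rfl
        exacts [hb, fun h => hb (E.isBorder_rev.1 h)]
      have heS : ∀ S, e ∈ E.covered S ↔ x ∈ E.covered S := fun S => by
        rcases he with rfl | rfl
        exacts [Iff.rfl, rev_mem_covered]
      obtain ⟨s, hs⟩ := exists_shot (S := S) (hec ▸ hc) heb (by rwa [heS])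
      obtain ⟨h1, -, h2⟩ := hs.insert hS (hec ▸ hc)
      obtain ⟨k, T, hk, hT, hX⟩ := ih h1
      refine ⟨k + 1, T, by omega, Shots.cons S T k e s hec (by convert hs) (by convert hT), ?_⟩
      intro y hy hyb hyc
      rcases Finset.mem_insert.1 hy with rfl | hy
      · exact covered_mono (hT.spec hc h1).2.2 ((heS _).1 h2)
      · exact hX y hy hyb hyc
    · obtain ⟨k, T, hk, hT, hX⟩ := ih hS
      refine ⟨k, T, by omega, hT, ?_⟩
      intro y hy hyb hyc
      rcases Finset.mem_insert.1 hy with rfl | hy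
      · have : y ∈ E.covered S := by
          by_contra h
          exact hneed ⟨hyb, hyc, h⟩
        exact covered_mono (hT.spec hc hS).2.2 this
      · exact hX y hy hyb hyc

/-- Shooting along a smallest saturating edge-set suffices, whatever is already covered. This makes
each greedy step possible and bounds its cost by the exponent. -/
theorem exists_saturating_shots [Finite D] {c : E.Cell} (hc : ¬ E.IsRegular c)
    {S : Finset (List D)} (hS : E.IsProperCutSet S) :
    ∃ k T, k ≤ E.exponent c ∧ E.Shots c S k T ∧ E.Saturates (E.covered T) c := by
  obtain ⟨X, hX, hsat⟩ := E.exists_saturates_card_eq_exponent c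
  obtain ⟨k, T, hk, hT, hcov⟩ := exists_shots hc X hS
  refine ⟨k, T, hX ▸ hk, hT, hsat.mono hc fun d hd hb hdX => ?_⟩
  rcases hdX with h | h | h
  · exact Or.inl (hcov d h hb (Or.inl hd))
  · exact Or.inr (Or.inl (hcov _ h (fun h' => hb (E.isBorder_rev.1 h'))
      (Or.inr (by rwa [E.rev_rev]))))
  · exact (hb h).elim

theorem exists_greedyStep [Finite D] {c : E.Cell} (hc : ¬ E.IsRegular c)
    {S : Finset (List D)} (hS : E.IsProperCutSet S) : ∃ T, E.GreedyStep c S T := by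
  classical
  have hex : ∃ k T, E.Shots c S k T ∧ E.Saturates (E.covered T) c := by
    obtain ⟨k, T, -, h⟩ := exists_saturating_shots hc hS
    exact ⟨k, T, h⟩
  obtain ⟨T, hT⟩ := Nat.find_spec hex
  exact ⟨T, Nat.find hex, hT.1, hT.2, fun k' T' h1 h2 => Nat.find_min' hex ⟨T', h1, h2⟩⟩

theorem GreedyStep.spec [Finite D] {c : E.Cell} {S T : Finset (List D)}
    (h : E.GreedyStep c S T) (hc : ¬ E.IsRegular c) (hS : E.IsProperCutSet S) :
    E.IsProperCutSet T ∧ T.card ≤ S.card + E.exponent c ∧ S ⊆ T ∧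
      E.Saturates (E.covered T) c := by
  obtain ⟨k, hk, hsat, hmin⟩ := h
  obtain ⟨h1, h2, h3⟩ := hk.spec hc hS
  obtain ⟨k', T', hk', hT', hsat'⟩ := exists_saturating_shots hc hS
  have := hmin k' T' hT' hsat'
  exact ⟨h1, by omega, h3, hsat⟩

theorem Saturates.mono_covered [Finite D] {c : E.Cell} {X : Set D} {T : Finset (List D)}
    (h : E.Saturates X c) (hc : ¬ E.IsRegular c) (hX : X ⊆ E.covered T) :
    E.Saturates (E.covered T) c :=
  h.mono hc fun _ _ _ hdX => hdX.imp (@hX _) (Or.imp_left (@hX _))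

theorem exists_greedyRun [Finite D] {order : List E.Cell} :
    ∀ {S : Finset (List D)}, (∀ c ∈ order, ¬ E.IsRegular c) → E.IsProperCutSet S →
      ∃ T, E.GreedyRun order S T := by
  induction order with
  | nil => exact fun {S} _ _ => ⟨S, rfl⟩
  | cons c cs ih =>
    intro S hc hS
    have hc' := hc c List.mem_cons_self
    obtain ⟨S', hS'⟩ := exists_greedyStep hc' hS
    obtain ⟨T, hT⟩ := ih (fun x hx => hc x (List.mem_cons_of_mem _ hx)) (hS'.spec hc' hS).1
    exact ⟨T, S', hS', hT⟩

theorem GreedyRun.spec [Finite D] {order : List E.Cell} :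
    ∀ {S T : Finset (List D)}, E.GreedyRun order S T → (∀ c ∈ order, ¬ E.IsRegular c) →
      E.IsProperCutSet S → E.IsProperCutSet T ∧
      T.card ≤ S.card + (order.map E.exponent).sum ∧ S ⊆ T ∧
      ∀ c ∈ order, E.Saturates (E.covered T) c := by
  induction order with
  | nil =>
    intro S T h _ hS
    obtain rfl : T = S := h
    exact ⟨hS, by simp, subset_rfl, by simp⟩
  | cons c cs ih =>
    rintro S T ⟨S', hS', hT⟩ hc hS
    have hc' := hc c List.mem_cons_self
    obtain ⟨h1, h2, h3, h4⟩ := hS'.spec hc' hS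
    obtain ⟨h5, h6, h7, h8⟩ := ih hT (fun x hx => hc x (List.mem_cons_of_mem _ hx)) h1
    refine ⟨h5, ?_, h3.trans h7, ?_⟩
    · rw [List.map_cons, List.sum_cons]
      omega
    · intro x hx
      rcases List.mem_cons.1 hx with rfl | hx
      · exact h4.mono_covered hc' (covered_mono h7)
      · exact h8 x hx

/-- A regular vertex is saturated by every cut-set. -/
theorem IsCutSet.saturates_regular [Finite D] {S : Finset (List D)} (hS : E.IsCutSet S)
    {c : E.Cell} (hc : E.IsRegular c) : E.Saturates (E.covered S) c := by
  rw [saturates_iff, thick_covered]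
  by_cases h : E.OnSegment S c
  · right
    obtain ⟨s, hs, h⟩ := (hS.onSegment_iff hc).1 h
    obtain ⟨x, hx, rfl⟩ := List.mem_map.1 h
    obtain ⟨y, hy, hr, hxy⟩ := exists_rel_of_mem_tail (hS.1 s hs).2.1 hx
    -- A segment passes straight through the vertex, so two opposite edges there are walls, and
    -- every pair of consecutive darts contains one of them.
    have h1 : E.rev y ∈ E.walls S := Or.inl ⟨s, hs, Or.inr (by rwa [E.rev_rev])⟩
    have h2 : E.next (E.next (E.rev y)) ∈ E.walls S :=
      Or.inl ⟨s, hs, Or.inl (by rw [← straight, ← hxy]; exact List.mem_of_mem_tail hx)⟩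
    intro e he
    rw [hxy, cell_straight hr] at he
    rcases E.eq_of_cell_eq_regular hr he with rfl | rfl | rfl | rfl
    exacts [Or.inl h1, Or.inr h2, Or.inl h2, Or.inr (by rwa [E.next_four hr])]
  · left
    refine ⟨hc, ?_⟩
    rintro d rfl (hd | hd)
    · exact h ⟨d, hd, rfl⟩
    · exact hc.1 d rfl hd

end StringSystem

open StringSystem in
theorem mainTheorem6 {D : Type*} [Finite D] (E : StringSystem D)
    (hδ : 3 ≤ E.delta ∨ ∃ R S, E.IsOptimal R ∧ E.Delimits S R ∧ 3 ≤ E.deltaRect S)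
    (order : List E.Cell) (hnodup : order.Nodup) (horder : ∀ c, c ∈ order ↔ 0 < E.exponent c) :
    (∃ S, E.GreedyRun order ∅ S) ∧
    ∀ S, E.GreedyRun order ∅ S →
      ∃ R, (E.IsRectangulation R ∧ E.Delimits S R) ∧
        (∀ R', E.IsRectangulation R' → E.Delimits S R' → R' = R) ∧
        (R.card : ℤ) ≤ 4 * (E.Ropt : ℤ) - 2 := by
  obtain ⟨Ro, So, hopt, hdel, hδ⟩ :
      ∃ R S, E.IsOptimal R ∧ E.Delimits S R ∧ 3 ≤ E.deltaRect S := by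
    rcases hδ with h | h
    · have hne : {k | ∃ R S, E.IsOptimal R ∧ E.Delimits S R ∧ E.deltaRect S = k}.Nonempty :=
        -- The infimum of an empty set of naturals is 0, so `δ ≥ 3` guarantees an optimal
        -- rectangulation with a delimiting cut-set, and the minimum is attained.
        Nat.nonempty_of_pos_sInf (lt_of_lt_of_le (by norm_num) h)
      obtain ⟨R, S, h1, h2, h3⟩ := Nat.sInf_mem hne
      exact ⟨R, S, h1, h2, h3 ▸ h⟩
    · exact h
  have hreg : ∀ c ∈ order, ¬ E.IsRegular c := fun c hc =>
    not_regular_of_exponent_pos ((horder c).1 hc)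
  refine ⟨exists_greedyRun hreg isProperCutSet_empty, fun S hS => ?_⟩
  obtain ⟨hcut, hcard, -, hsat⟩ := hS.spec hreg isProperCutSet_empty
  have hsat' : ∀ c, E.Saturates (E.covered S) c := by
    intro c
    by_cases hc : E.IsRegular c
    · exact hcut.cutSet.saturates_regular hc
    · rcases Nat.eq_zero_or_pos (E.exponent c) with h | h
      -- Non-regular vertices outside the order have exponent 0: the border alone, or nothing beyond
      -- it, already saturates them, and added segments preserve this.
      · obtain ⟨X, hX, hXc⟩ := E.exists_saturates_card_eq_exponent c
        obtain rfl : X = ∅ := Finset.card_eq_zero.1 (hX.trans h)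
        exact hXc.mono_covered hc (by simp)
      · exact hsat c ((horder c).2 h)
  obtain ⟨R, hR, hblock⟩ := (isFlat_of_saturates hsat').exists_rectangulation
  have hRdel := (delimits_iff hR hcut.cutSet hcut.not_isBorder).2 fun r hr => (hblock r).1 hr
  refine ⟨R, ⟨hR, hRdel⟩, fun R' hR' hdel' => ?_, ?_⟩
  · exact eq_of_forall_isBlock hR' hR (hdel'.isBlock hR') fun r hr => (hblock r).1 hr
  · have hRopt : E.Ropt = Ro.card := by
      refine le_antisymm (Nat.sInf_le ⟨Ro, hopt.1, rfl⟩) ?_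
      obtain ⟨R', hR', h⟩ := Nat.sInf_mem
        (⟨_, Ro, hopt.1, rfl⟩ : {k | ∃ R, E.IsRectangulation R ∧ R.card = k}.Nonempty)
      exact (hopt.2 R' hR').trans h.le
    have h1 := sum_exponent_le hdel hopt.1 hnodup hreg
    have h2 := hdel.card_le hopt.1 hδ hRdel hR (by
      rw [Finset.card_empty, zero_add] at hcard
      exact hcard.trans h1)
    rw [hRopt]
    omega
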